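/- Let $n\ge 1$ and $r\ge 0$ be integers and let $p,q\in[1,\infty)$ satisfy either (i) $p\ge q$ and $\frac1q-\frac1p<\frac1n$, or (ii) $p<q$. Let $D\subset\mathbb R^n$ be a bounded convex set with non-empty interior, of volume $\mathrm{Vol}(D)$ and diameter $R$, and let $\omega$ be a smooth differential $r$-form on $D$. Put $$\|\alpha\|_{L^s(D)}=\Big(\int_D|\alpha(x)|^s\,dx\Big)^{1/s}\in[0,\infty],$$ where $|\cdot|$ is the Euclidean norm on alternating forms, for which the $dx_{i_1}\wedge\dots\wedge dx_{i_k}$, $i_1<\dots<i_k$, are orthonormal, and put $$c=\mathrm{Vol}(D)^{1/p-1/q}\,C(p,q,r,n)\,R,\qquad C(p,q,r,n)=\begin{cases}\int_0^1\min\big(t^{n/p},(1-t)^{n/p}\big)\,t^{r-n/p}(1-t)^{-n/q}\,dt&\text{in case (i)},\\[2pt]\int_0^1\min\big(t^{n/q},(1-t)^{n/q}\big)\,t^{r-n/q}(1-t)^{-n/q}\,dt&\text{in case (ii)}.\end{cases}$$ (a) There exists a smooth $r$-form $\xi$ on $D$ such that $$d\xi=d\omega\quad\text{on }D,\qquad \|\xi\|_{L^p(D)}\le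 c\,\|d\omega\|_{L^q(D)}.$$ For $y\in D$ let $\psi_y(x,t)=tx+(1-t)y$, and for a form $\alpha$ of positive degree on $D$ let $K_y\alpha=\int_0^1\psi_y^*\alpha$ (integration over the fibre $[0,1]$: write $\psi_y^*\alpha=\alpha_0+dt\wedge\alpha_1$ with $\alpha_0,\alpha_1$ free of $dt$ and integrate $\alpha_1$ over $t\in[0,1]$), and $A\alpha(x)=\frac1{\mathrm{Vol}(D)}\int_D K_y\alpha(x)\,dy$. (b) If $\|d\omega\|_{L^q(D)}<\infty$, then the integral that defines $A\,d\omega(x)$ converges absolutely for almost every $x\in D$, and $\|A\,d\omega\|_{L^p(D)}\le c\,\|d\omega\|_{L^q(D)}$. (c) If $D$ is compact, then $\|d\omega\|_{L^q(D)}<\infty$, the integral that defines $A\,d\omega(x)$ converges absolutely for every $x\in D$, $A\,d\omega$ is a smooth $r$-form on $D$, and $d(A\,d\omega)=d\omega$ on $D$; so, by (b), one may take $\xi=A\,d\omega$ in (a). -/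

import Mathlib

open MeasureTheory Set

noncomputable section

/-- The pointwise (Riemannian, i.e. Euclidean) norm of an alternating `r`-form `α` on `ℝⁿ`:
`|α|² = ∑ α(e_{i₁}, …, e_{iᵣ})²` over all `i₁ < ⋯ < iᵣ`, so that the forms
`dx_{i₁} ∧ ⋯ ∧ dx_{iᵣ}` are orthonormal. -/
def formNorm {n r : ℕ} (α : EuclideanSpace ℝ (Fin n) [⋀^Fin r]→L[ℝ] ℝ) : ℝ :=
  open Classical in
  √(∑ I : Fin r → Fin n with StrictMono I,
      (α fun j => EuclideanSpace.single (I j) (1 : ℝ)) ^ 2)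

/-- The `L^p` norm over `D` of a differential form, `(∫_D |ω|^p dVol)^{1/p}`, with values
in `[0, ∞]`. -/
def formLpNorm {n r : ℕ} (p : ℝ) (D : Set (EuclideanSpace ℝ (Fin n)))
    (ω : EuclideanSpace ℝ (Fin n) → EuclideanSpace ℝ (Fin n) [⋀^Fin r]→L[ℝ] ℝ) : ENNReal :=
  eLpNorm (fun x => formNorm (ω x)) (ENNReal.ofReal p) (volume.restrict D)

/-- The pullback `f^* ω` of a differential form under a differentiable map. -/
def formPullback {E F : Type*} [NormedAddCommGroup E] [NormedSpace ℝ E]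
    [NormedAddCommGroup F] [NormedSpace ℝ F] {k : ℕ}
    (f : F → E) (ω : E → E [⋀^Fin k]→L[ℝ] ℝ) (z : F) : F [⋀^Fin k]→L[ℝ] ℝ :=
  (ω (f z)).compContinuousLinearMap (fderiv ℝ f z)

/-- The radial contraction `ψ_y (x, t) = t x + (1 - t) y`. -/
def radialMap {n : ℕ} (y : EuclideanSpace ℝ (Fin n)) (z : EuclideanSpace ℝ (Fin n) × ℝ) :
    EuclideanSpace ℝ (Fin n) :=
  z.2 • z.1 + (1 - z.2) • y

/-- The homotopy operator `K_y ω = ∫₀¹ ψ_y^* ω`, integration over the fibre `[0, 1]`: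
writing `ψ_y^* ω = α₀ + dt ∧ α₁` with `α₀, α₁` free of `dt`, the form `α₁` is the contraction
of `ψ_y^* ω` with `∂/∂t = (0, 1)`, restricted to the vectors `(v, 0)`, and
`K_y ω (x) = ∫₀¹ α₁ (x, t) dt`. -/
def homotopyOp {n r : ℕ} (y : EuclideanSpace ℝ (Fin n))
    (ω : EuclideanSpace ℝ (Fin n) → EuclideanSpace ℝ (Fin n) [⋀^Fin (r + 1)]→L[ℝ] ℝ)
    (x : EuclideanSpace ℝ (Fin n)) : EuclideanSpace ℝ (Fin n) [⋀^Fin r]→L[ℝ] ℝ :=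
  ∫ t in (0 : ℝ)..1,
    ((formPullback (radialMap y) ω (x, t)).curryLeft
      ((0 : EuclideanSpace ℝ (Fin n)), (1 : ℝ))).compContinuousLinearMap
        (ContinuousLinearMap.inl ℝ (EuclideanSpace ℝ (Fin n)) ℝ)

/-- The averaged homotopy operator `A ω (x) = Vol(D)⁻¹ ∫_D K_y ω (x) dy`. -/
def avgHomotopyOp {n r : ℕ} (D : Set (EuclideanSpace ℝ (Fin n)))
    (ω : EuclideanSpace ℝ (Fin n) → EuclideanSpace ℝ (Fin n) [⋀^Fin (r + 1)]→L[ℝ] ℝ)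
    (x : EuclideanSpace ℝ (Fin n)) : EuclideanSpace ℝ (Fin n) [⋀^Fin r]→L[ℝ] ℝ :=
  (volume.real D)⁻¹ • ∫ y in D, homotopyOp y ω x

/-- The constant `C(p, q, r, n)`. -/
def poincareConst (p q : ℝ) (r n : ℕ) : ℝ :=
  if q ≤ p then
    ∫ t in (0 : ℝ)..1,
      min (t ^ ((n : ℝ) / p)) ((1 - t) ^ ((n : ℝ) / p)) *
        t ^ ((r : ℝ) - (n : ℝ) / p) * (1 - t) ^ (-((n : ℝ) / q))
  else
    ∫ t in (0 : ℝ)..1,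
      min (t ^ ((n : ℝ) / q)) ((1 - t) ^ ((n : ℝ) / q)) *
        t ^ ((r : ℝ) - (n : ℝ) / q) * (1 - t) ^ (-((n : ℝ) / q))

end

/-! Put `α = dω`, a closed form. By Cartan's formula `d` applied to the integrand of `K_y α` is the
`t`-derivative of `t ^ (r + 1) • α (t x + (1 - t) y)`, so `d (K_y α) = α` for every `y`, and every
average over base points inverts `d` as long as one may differentiate under the integral. A compact
convex set `P` of base points allows this (`extDerivWithin_avgHomotopyOp`,
`contDiffOn_avgHomotopyOp`).

For the estimate, contraction with `x - y` costs at most `‖x - y‖ ≤ R`, hence `|Aα|` is bounded by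
an average over `(y, t)` of `t ^ r R |α| (t x + (1 - t) y)`. For fixed `t` the map `g ↦ ∫ g (t x +
(1 - t) y) dy` goes from `L^q` to `L^p` if `q ≤ p`, with a norm found by substituting in `y` or in
`x` (`lintegral_rpow_segment_le`). Minkowski's inequality integrates these norms over `t`, which
gives the constant (`lintegral_rpow_radial_le`). For `p < q` one takes the pair `(q, q)` and then
Hölder on the bounded domain.

If `D` is not compact, `α` may blow up at the boundary and smoothness of the average over `D` is not
available. One averages instead over a compact convex `P` in the interior, at the price of a factor
`Vol D / Vol P`. It costs nothing in the end: `‖x - y‖ < R` strictly for interior points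
(`norm_sub_lt_diam`), so when `α ≠ 0` has finite norm the estimate has slack, and `P` is chosen to
fill almost all of the volume (`exists_isCompact_convex_subset`). -/

noncomputable section

/-! ### The Euclidean norm on alternating forms. -/

section

/-- Riesz representation and Parseval; the point is that the right side mentions no basis. -/
lemma sum_sq_apply_orthonormalBasis {ι E : Type*} [Fintype ι] [NormedAddCommGroup E]
    [InnerProductSpace ℝ E] [FiniteDimensional ℝ E] (b : OrthonormalBasis ι ℝ E) (L : E →ₗ[ℝ] ℝ) :
    ∑ i, L (b i) ^ 2 = ‖L.toContinuousLinearMap‖ ^ 2 := by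
  have : CompleteSpace E := FiniteDimensional.complete ℝ E
  set w := (InnerProductSpace.toDual ℝ E).symm L.toContinuousLinearMap
  have h : ∀ v, L v = inner ℝ w v := fun v => by
    simp [w, InnerProductSpace.toDual_symm_apply]
  have h2 : ‖L.toContinuousLinearMap‖ = ‖w‖ := by simp [w]
  rw [h2, ← b.sum_sq_norm_inner_left w]
  simp [h]

/-- The Hilbert–Schmidt norm of a multilinear form does not depend on the orthonormal basis. -/
lemma MultilinearMap.sum_sq_apply_orthonormalBasis_eq {ι E : Type*} [Fintype ι]
    [NormedAddCommGroup E] [InnerProductSpace ℝ E] [FiniteDimensional ℝ E]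
    (b b' : OrthonormalBasis ι ℝ E) {k : ℕ} (f : MultilinearMap ℝ (fun _ : Fin k => E) ℝ) :
    ∑ I : Fin k → ι, f (fun j => b (I j)) ^ 2 = ∑ I : Fin k → ι, f (fun j => b' (I j)) ^ 2 := by
  induction k with
  | zero =>
    refine Finset.sum_congr rfl fun I _ => ?_
    congr 2
    exact Subsingleton.elim _ _
  | succ k ih =>
    have key : ∀ c : OrthonormalBasis ι ℝ E, ∑ I : Fin (k + 1) → ι, f (fun j => c (I j)) ^ 2
        = ∑ i, ∑ I : Fin k → ι, f.curryLeft (c i) (fun j => c (I j)) ^ 2 := fun c => by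
      rw [← Fintype.sum_prod_type']
      refine (Fintype.sum_equiv (Fin.consEquiv fun _ => ι) _ _ ?_).symm
      rintro ⟨i, I⟩
      simp only [MultilinearMap.curryLeft_apply, Fin.consEquiv]
      congr 2
      funext j
      refine Fin.cases ?_ (fun j => ?_) j <;> simp
    rw [key b, key b']
    -- The last `k` slots pass to `b'` by induction. With these slots fixed, the first one is a
    -- linear functional, to which Parseval applies.
    simp_rw [ih]
    rw [Finset.sum_comm]
    conv_rhs => rw [Finset.sum_comm]
    refine Finset.sum_congr rfl fun I _ => ?_
    let L : E →ₗ[ℝ] ℝ :=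
      { toFun := fun v => f.curryLeft v (fun j => b' (I j))
        map_add' := fun v w => by rw [map_add, add_apply]
        map_smul' := fun c v => by rw [map_smul, smul_apply, RingHom.id_apply] }
    exact (sum_sq_apply_orthonormalBasis b L).trans (sum_sq_apply_orthonormalBasis b' L).symm

/-- Summing the squares of the values of an alternating form over all multi-indices counts every
increasing multi-index `k!` times. -/
lemma AlternatingMap.sum_sq_eq_factorial_mul {n k : ℕ} {E : Type*} [AddCommGroup E] [Module ℝ E]
    (f : E [⋀^Fin k]→ₗ[ℝ] ℝ) (b : Fin n → E) :
    open Classical in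
    ∑ I : Fin k → Fin n, f (fun j => b (I j)) ^ 2 =
      (Nat.factorial k : ℝ) * ∑ I : Fin k → Fin n with StrictMono I, f (fun j => b (I j)) ^ 2 := by
  classical
  have h1 : ∑ I : Fin k → Fin n, f (fun j => b (I j)) ^ 2 =
      ∑ I : Fin k → Fin n with Function.Injective I, f (fun j => b (I j)) ^ 2 := by
    rw [Finset.sum_filter]
    refine Finset.sum_congr rfl fun I _ => ?_
    split_ifs with h
    · rfl
    · rw [f.map_eq_zero_of_not_injective]
      · simp
      · intro h'
        exact h (Function.Injective.of_comp (f := b) h')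
  -- An injective multi-index is uniquely an increasing one composed with a permutation, found by
  -- sorting.
  have h2 : ∑ I : Fin k → Fin n with Function.Injective I, f (fun j => b (I j)) ^ 2 =
      ∑ x ∈ (Finset.univ.filter fun I : Fin k → Fin n => StrictMono I) ×ˢ
        (Finset.univ : Finset (Equiv.Perm (Fin k))), f (fun j => b (x.1 (x.2 j))) ^ 2 := by
    symm
    refine Finset.sum_bij (fun x _ => x.1 ∘ x.2) ?_ ?_ ?_ ?_
    · rintro ⟨I, σ⟩ h
      simp only [Finset.mem_product, Finset.mem_filter, Finset.mem_univ, true_and, and_true] at h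
      simpa using h.injective
    · rintro ⟨I, σ⟩ h ⟨I', σ'⟩ h' e
      simp only [Finset.mem_product, Finset.mem_filter, Finset.mem_univ, true_and, and_true] at h h'
      simp only at e
      have hI : I = I' := by
        apply (StrictMono.range_inj h h').1
        rw [← σ.surjective.range_comp I, ← σ'.surjective.range_comp I', e]
      subst hI
      refine Prod.ext rfl (Equiv.ext fun j => h.injective (congrFun e j))
    · intro J hJ
      simp only [Finset.mem_filter, Finset.mem_univ, true_and] at hJ
      refine ⟨(J ∘ Tuple.sort J, (Tuple.sort J)⁻¹), ?_, ?_⟩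
      · simp only [Finset.mem_product, Finset.mem_filter, Finset.mem_univ, true_and, and_true]
        exact (Tuple.monotone_sort J).strictMono_of_injective
          (hJ.comp (Tuple.sort J).injective)
      · funext j; simp
    · intros; rfl
  rw [h1, h2, Finset.sum_product, Finset.mul_sum]
  refine Finset.sum_congr rfl fun I _ => ?_
  have : ∀ σ : Equiv.Perm (Fin k), f (fun j => b (I (σ j))) ^ 2 = f (fun j => b (I j)) ^ 2 := by
    intro σ
    have := f.map_perm (fun j => b (I j)) σ
    rw [show (fun j => b (I (σ j))) = (fun j => b (I j)) ∘ σ from rfl, this]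
    rcases Int.units_eq_one_or (Equiv.Perm.sign σ) with h | h <;> simp [h]
  simp [this, Fintype.card_perm]

variable {n r : ℕ}

/-- Both sides are `1 / r!` times sums over all multi-indices, which do not depend on the basis.
This lets a basis be adapted to a given vector. -/
lemma formNorm_sq (α : EuclideanSpace ℝ (Fin n) [⋀^Fin r]→L[ℝ] ℝ)
    (b : OrthonormalBasis (Fin n) ℝ (EuclideanSpace ℝ (Fin n))) :
    open Classical in
    formNorm α ^ 2 = ∑ I : Fin r → Fin n with StrictMono I, α (fun j => b (I j)) ^ 2 := by
  classical
  rw [formNorm, Real.sq_sqrt (Finset.sum_nonneg fun _ _ => sq_nonneg _)]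
  have h := MultilinearMap.sum_sq_apply_orthonormalBasis_eq b (EuclideanSpace.basisFun (Fin n) ℝ)
    α.toMultilinearMap
  have e1 := AlternatingMap.sum_sq_eq_factorial_mul α.toAlternatingMap b
  have e2 := AlternatingMap.sum_sq_eq_factorial_mul α.toAlternatingMap
    (EuclideanSpace.basisFun (Fin n) ℝ)
  have hf : (Nat.factorial r : ℝ) ≠ 0 := by positivity
  refine mul_left_cancel₀ hf ?_
  simp only [EuclideanSpace.basisFun_apply] at h e2
  exact e2.symm.trans (h.symm.trans e1)

lemma formNorm_nonneg (α : EuclideanSpace ℝ (Fin n) [⋀^Fin r]→L[ℝ] ℝ) : 0 ≤ formNorm α :=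
  Real.sqrt_nonneg _

lemma formNorm_smul (c : ℝ) (α : EuclideanSpace ℝ (Fin n) [⋀^Fin r]→L[ℝ] ℝ) :
    formNorm (c • α) = |c| * formNorm α := by
  classical
  rw [formNorm, formNorm, ← Real.sqrt_sq_eq_abs, ← Real.sqrt_mul (sq_nonneg c), Finset.mul_sum]
  simp [mul_pow]

/-- Contraction with a vector `v` increases the Euclidean norm of forms by at most `‖v‖`. -/
lemma formNorm_curryLeft_le (α : EuclideanSpace ℝ (Fin n) [⋀^Fin (r + 1)]→L[ℝ] ℝ)
    (v : EuclideanSpace ℝ (Fin n)) : formNorm (α.curryLeft v) ≤ ‖v‖ * formNorm α := by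
  classical
  rcases eq_or_ne v 0 with rfl | hv
  · simp [formNorm]
  have hn : 0 < n := by
    rcases Nat.eq_zero_or_pos n with rfl | h
    · exact absurd (Subsingleton.elim v 0) hv
    · exact h
  have hv' : ‖v‖ ≠ 0 := norm_ne_zero_iff.2 hv
  set u : EuclideanSpace ℝ (Fin n) := ‖v‖⁻¹ • v with hu
  have hu1 : ‖u‖ = 1 := by rw [hu, norm_smul, norm_inv, norm_norm, inv_mul_cancel₀ hv']
  have hvu : v = ‖v‖ • u := by rw [hu, smul_smul, mul_inv_cancel₀ hv', one_smul]
  -- The unit vector `u` becomes the basis vector of least index, so that prefixing `i0` to an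
  -- increasing multi-index that avoids `i0` leaves it increasing.
  let i0 : Fin n := ⟨0, hn⟩
  obtain ⟨b, hb⟩ := Orthonormal.exists_orthonormalBasis_extension_of_card_eq (ι := Fin n) (𝕜 := ℝ)
    (v := fun _ : Fin n => u) (s := {i0}) (by simp) (by
      refine ⟨fun i => hu1, fun i j hij => (hij (Subsingleton.elim i j)).elim⟩)
  have hb0 : b i0 = u := hb i0 rfl
  suffices formNorm (α.curryLeft u) ≤ formNorm α by
    rw [hvu, map_smul, formNorm_smul, ← hvu, abs_of_nonneg (norm_nonneg _)]
    gcongr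
  refine le_of_sq_le_sq ?_ (formNorm_nonneg _)
  rw [formNorm_sq _ b, formNorm_sq _ b]
  have h1 : ∀ I : Fin r → Fin n, α.curryLeft u (fun j => b (I j)) ^ 2 =
      α (fun j => b ((Fin.cons i0 I : Fin (r + 1) → Fin n) j)) ^ 2 := fun I => by
    rw [ContinuousAlternatingMap.curryLeft_apply_apply]
    congr 2
    funext j
    refine Fin.cases ?_ (fun j => ?_) j <;> simp [hb0]
  simp_rw [h1]
  -- A repeated argument kills these terms. The remaining ones are distinct terms of the sum for
  -- `α`.
  have h2 : ∀ I : Fin r → Fin n, StrictMono I → (∃ j, I j = i0) →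
      α (fun j => b ((Fin.cons i0 I : Fin (r + 1) → Fin n) j)) ^ 2 = 0 := by
    rintro I - ⟨j, hj⟩
    rw [α.map_eq_zero_of_eq _ (i := 0) (j := j.succ) (by simp [hj]) (Fin.succ_ne_zero j).symm]
    simp
  calc _ = ∑ I : Fin r → Fin n with StrictMono I ∧ ∀ j, I j ≠ i0,
        α (fun j => b ((Fin.cons i0 I : Fin (r + 1) → Fin n) j)) ^ 2 := by
        rw [Finset.sum_filter, Finset.sum_filter]
        refine Finset.sum_congr rfl fun I _ => ?_
        by_cases hI : StrictMono I
        · by_cases h : ∀ j, I j ≠ i0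
          · simp [hI, h]
          · rw [h2 I hI (by push Not at h; exact h)]; simp
        · simp [hI]
    _ = ∑ J ∈ (Finset.univ.filter fun I : Fin r → Fin n => StrictMono I ∧ ∀ j, I j ≠ i0).image
          (fun I => (Fin.cons i0 I : Fin (r + 1) → Fin n)), α (fun j => b (J j)) ^ 2 := by
        rw [Finset.sum_image]
        intro I _ J _ h
        exact Fin.cons_right_injective (α := fun _ => Fin n) i0 h
    _ ≤ _ := by
        refine Finset.sum_le_sum_of_subset_of_nonneg ?_ fun _ _ _ => sq_nonneg _
        intro J hJ
        simp only [Finset.mem_image, Finset.mem_filter, Finset.mem_univ, true_and] at hJ ⊢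
        obtain ⟨I, ⟨hI, hI0⟩, rfl⟩ := hJ
        intro a c hac
        induction c using Fin.cases with
        | zero => exact absurd hac (Fin.not_lt_zero a)
        | succ c =>
          induction a using Fin.cases with
          | zero =>
            simp only [Fin.cons_zero, Fin.cons_succ]
            exact lt_of_le_of_ne (Fin.mk_le_of_le_val (Nat.zero_le _)) (hI0 c).symm
          | succ a => simpa using hI (Fin.succ_lt_succ_iff.1 hac)

/-- The coordinates of an alternating form in the basis `dx_{i₁} ∧ ⋯ ∧ dx_{iᵣ}`. -/
def formCoordsLinear (n r : ℕ) : (EuclideanSpace ℝ (Fin n) [⋀^Fin r]→L[ℝ] ℝ) →ₗ[ℝ]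
    EuclideanSpace ℝ {I : Fin r → Fin n // StrictMono I} where
  toFun α := WithLp.toLp 2 fun I => α fun j => EuclideanSpace.single (I.1 j) (1 : ℝ)
  map_add' α β := by ext; simp
  map_smul' c α := by ext; simp

lemma norm_formCoordsLinear (α : EuclideanSpace ℝ (Fin n) [⋀^Fin r]→L[ℝ] ℝ) :
    ‖formCoordsLinear n r α‖ = formNorm α := by
  classical
  rw [EuclideanSpace.norm_eq, formNorm]
  congr 1
  simp only [formCoordsLinear, LinearMap.coe_mk, AddHom.coe_mk, Real.norm_eq_abs, sq_abs]
  symm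
  refine Finset.sum_subtype (p := fun I : Fin r → Fin n => StrictMono I) _ (fun I => ?_)
    (fun I => (α fun j => EuclideanSpace.single (I j) (1 : ℝ)) ^ 2)
  simp

lemma formNorm_eq_zero {α : EuclideanSpace ℝ (Fin n) [⋀^Fin r]→L[ℝ] ℝ} :
    formNorm α = 0 ↔ α = 0 := by
  classical
  refine ⟨fun h => ?_, by rintro rfl; simp [formNorm]⟩
  have e2 := AlternatingMap.sum_sq_eq_factorial_mul α.toAlternatingMap
    (EuclideanSpace.basisFun (Fin n) ℝ)
  have h2 := formNorm_sq α (EuclideanSpace.basisFun (Fin n) ℝ)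
  rw [h] at h2
  have h3 : ∑ I : Fin r → Fin n,
      α (fun j => EuclideanSpace.basisFun (Fin n) ℝ (I j)) ^ 2 = 0 := by
    refine e2.trans ?_
    have := h2.symm
    simp only [ne_eq, OfNat.ofNat_ne_zero, not_false_eq_true, zero_pow] at this
    exact mul_eq_zero_of_right _ this
  rw [Finset.sum_eq_zero_iff_of_nonneg fun _ _ => sq_nonneg _] at h3
  apply ContinuousAlternatingMap.toAlternatingMap_injective
  refine Module.Basis.ext_alternating (EuclideanSpace.basisFun (Fin n) ℝ).toBasis fun I _ => ?_
  have := h3 I (Finset.mem_univ _)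
  simpa using this

lemma formCoordsLinear_injective (n r : ℕ) : Function.Injective (formCoordsLinear n r) := by
  refine (injective_iff_map_eq_zero _).2 fun α h => formNorm_eq_zero.1 ?_
  rw [← norm_formCoordsLinear, h, norm_zero]

instance finiteDimensional_form (n r : ℕ) :
    FiniteDimensional ℝ (EuclideanSpace ℝ (Fin n) [⋀^Fin r]→L[ℝ] ℝ) :=
  FiniteDimensional.of_injective (formCoordsLinear n r) (formCoordsLinear_injective n r)

/-- `formCoordsLinear` as a continuous linear map. -/
def formCoords (n r : ℕ) : (EuclideanSpace ℝ (Fin n) [⋀^Fin r]→L[ℝ] ℝ) →L[ℝ]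
    EuclideanSpace ℝ {I : Fin r → Fin n // StrictMono I} :=
  (formCoordsLinear n r).toContinuousLinearMap

lemma norm_formCoords (α : EuclideanSpace ℝ (Fin n) [⋀^Fin r]→L[ℝ] ℝ) :
    ‖formCoords n r α‖ = formNorm α := norm_formCoordsLinear α

lemma enorm_formNorm (α : EuclideanSpace ℝ (Fin n) [⋀^Fin r]→L[ℝ] ℝ) :
    ‖formNorm α‖ₑ = ‖formCoords n r α‖ₑ := by
  rw [← norm_formCoords, enorm_norm]

lemma continuous_formNorm :
    Continuous (formNorm : (EuclideanSpace ℝ (Fin n) [⋀^Fin r]→L[ℝ] ℝ) → ℝ) := by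
  have : (formNorm : (EuclideanSpace ℝ (Fin n) [⋀^Fin r]→L[ℝ] ℝ) → ℝ) =
      fun α => ‖formCoords n r α‖ := funext fun α => (norm_formCoords α).symm
  rw [this]
  fun_prop

/-- Bochner integrability refers to the operator norm, whereas the estimates are made in `formNorm`;
finite dimension makes the two comparable. -/
lemma exists_norm_le_formNorm (n r : ℕ) : ∃ C : ℝ, 0 < C ∧
    ∀ α : EuclideanSpace ℝ (Fin n) [⋀^Fin r]→L[ℝ] ℝ, ‖α‖ ≤ C * formNorm α := by
  obtain ⟨K, hK, h⟩ := (formCoordsLinear n r).exists_antilipschitzWith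
    (LinearMap.ker_eq_bot.2 (formCoordsLinear_injective n r))
  refine ⟨K, hK, fun α => ?_⟩
  have := h.le_mul_dist α 0
  simpa [norm_formCoordsLinear] using this

/-- `formNorm` is a norm after the linear map `formCoords`, which commutes with the integral. For a
non-integrable `f` the integral is `0` by convention. -/
lemma enorm_formNorm_integral_le {X : Type*} [MeasurableSpace X] (μ : Measure X)
    (f : X → EuclideanSpace ℝ (Fin n) [⋀^Fin r]→L[ℝ] ℝ) :
    ‖formNorm (∫ x, f x ∂μ)‖ₑ ≤ ∫⁻ x, ‖formNorm (f x)‖ₑ ∂μ := by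
  by_cases hf : Integrable f μ
  · simp_rw [enorm_formNorm]
    rw [← (formCoords n r).integral_comp_comm hf]
    exact enorm_integral_le_lintegral_enorm _
  · rw [integral_undef hf, formNorm_eq_zero.2 rfl]
    simp

end

/-! ### Smoothness of integrals depending on a parameter. -/

section

open Filter Topology in
/-- Differentiation within a convex set under the integral over a compact set of parameters. -/
lemma hasFDerivWithinAt_setIntegral_of_continuousOn {E H G : Type*}
    [NormedAddCommGroup E] [NormedSpace ℝ E] [TopologicalSpace H] [T2Space H]
    [MeasurableSpace H] [BorelSpace H] [NormedAddCommGroup G] [NormedSpace ℝ G] [CompleteSpace G]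
    {S : Set E} {K : Set H} (hS : Convex ℝ S) (hK : IsCompact K)
    (μ : Measure H) [IsFiniteMeasureOnCompacts μ]
    {f : E → H → G} {f' : E → H → E →L[ℝ] G}
    (hf : ∀ k ∈ K, ∀ x ∈ S, HasFDerivWithinAt (f · k) (f' x k) S x)
    (hfc : ∀ x ∈ S, ContinuousOn (f x) K)
    (hf'c : ContinuousOn (Function.uncurry f') (S ×ˢ K)) {x : E} (hx : x ∈ S) :
    HasFDerivWithinAt (fun x => ∫ k in K, f x k ∂μ) (∫ k in K, f' x k ∂μ) S x := by
  have hint : ∀ x ∈ S, IntegrableOn (f x) K μ := fun x hx => (hfc x hx).integrableOn_compact hK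
  have hint' : IntegrableOn (f' x) K μ := by
    refine ContinuousOn.integrableOn_compact hK ?_
    exact hf'c.comp (f := fun k => (x, k)) (by fun_prop) fun k hk => ⟨hx, hk⟩
  have hfin : μ K < ⊤ := hK.measure_lt_top
  rw [hasFDerivWithinAt_iff_isLittleO, Asymptotics.isLittleO_iff]
  intro c hc
  set m := μ.real K
  -- The `+ 1` covers a null set `K`.
  set ε := c / (m + 1) with hε
  have hm : 0 ≤ m := measureReal_nonneg
  have hε0 : 0 < ε := by positivity
  -- Compactness of `K` makes the continuity of `f'` at `x` uniform in `k`; the mean value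
  -- inequality on the convex set `S ∩ ball x δ` then gives a uniform remainder.
  have hev : ∀ᶠ x' in 𝓝 x, ∀ k ∈ K, x' ∈ S → ‖f' x' k - f' x k‖ ≤ ε := by
    refine (hK.eventually_forall_of_forall_eventually
      (P := fun x' k => (x', k) ∈ S ×ˢ K → ‖f' x' k - f' x k‖ ≤ ε) fun k hk => ?_).mono
        fun x' h k hk hx' => h k hk ⟨hx', hk⟩
    have h1 := hf'c (x, k) ⟨hx, hk⟩
    have h2 : ContinuousWithinAt (fun z : E × H => f' x z.2) (S ×ˢ K) (x, k) :=
      ContinuousWithinAt.comp (g := Function.uncurry f') (f := fun z : E × H => (x, z.2)) h1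
        (by fun_prop) fun z hz => ⟨hx, hz.2⟩
    have h3 := (h1.sub h2).norm
    have h4 : ∀ᶠ z in 𝓝[S ×ˢ K] (x, k), ‖f' z.1 z.2 - f' x z.2‖ < ε :=
      h3.eventually_lt_const (by simpa using hε0)
    exact (eventually_nhdsWithin_iff.1 h4).mono fun z hz hzS => (hz hzS).le
  obtain ⟨δ, hδ, hball⟩ := Metric.eventually_nhds_iff_ball.1 hev
  filter_upwards [inter_mem_nhdsWithin S (Metric.ball_mem_nhds x hδ)] with x' hx'
  have hbound : ∀ k ∈ K, ‖f x' k - f x k - f' x k (x' - x)‖ ≤ ε * ‖x' - x‖ := fun k hk =>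
    Convex.norm_image_sub_le_of_norm_hasFDerivWithin_le' (𝕜 := ℝ) (f := (f · k))
      (f' := fun z => f' z k) (s := S ∩ Metric.ball x δ)
      (fun z hz => (hf k hk z hz.1).mono inter_subset_left)
      (fun z hz => hball z hz.2 k hk hz.1) (hS.inter (convex_ball x δ))
      ⟨hx, Metric.mem_ball_self hδ⟩ hx'
  have e : (∫ k in K, f x' k ∂μ) - (∫ k in K, f x k ∂μ) - (∫ k in K, f' x k ∂μ) (x' - x) =
      ∫ k in K, (f x' k - f x k - f' x k (x' - x)) ∂μ := by
    rw [ContinuousLinearMap.integral_apply hint', integral_sub, integral_sub]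
    · exact hint x' hx'.1
    · exact hint x hx
    · exact (hint x' hx'.1).sub (hint x hx)
    · exact hint'.apply_continuousLinearMap _
  rw [e]
  calc _ ≤ ε * ‖x' - x‖ * m := norm_setIntegral_le_of_norm_le_const hfin hbound
    _ = (c * (m / (m + 1))) * ‖x' - x‖ := by rw [hε]; ring
    _ ≤ c * ‖x' - x‖ := by
      gcongr
      refine mul_le_of_le_one_right hc.le ?_
      rw [div_le_one (by positivity)]
      linarith

section
universe u
variable {E : Type u} {H : Type*} [NormedAddCommGroup E] [NormedSpace ℝ E]
    [NormedAddCommGroup H] [NormedSpace ℝ H] {S : Set E} {K : Set H}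

/-- The partial derivative of `F` in the first variable, within `S ×ˢ K`. -/
def fderivFstWithin {G : Type*} [NormedAddCommGroup G] [NormedSpace ℝ G] (F : E × H → G)
    (S : Set E) (K : Set H) (z : E × H) : E →L[ℝ] G :=
  (fderivWithin ℝ F (S ×ˢ K) z).comp (ContinuousLinearMap.inl ℝ E H)

lemma hasFDerivWithinAt_fderivFstWithin {G : Type*} [NormedAddCommGroup G] [NormedSpace ℝ G]
    {F : E × H → G} (hF : DifferentiableOn ℝ F (S ×ˢ K)) {x : E} {k : H} (hx : x ∈ S)
    (hk : k ∈ K) :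
    HasFDerivWithinAt (fun x => F (x, k)) (fderivFstWithin F S K (x, k)) S x := by
  refine (hF (x, k) ⟨hx, hk⟩).hasFDerivWithinAt.comp (f := fun x => (x, k)) x ?_
    fun z hz => ⟨hz, hk⟩
  exact (hasFDerivAt_prodMk_left x k).hasFDerivWithinAt

lemma contDiffOn_fderivFstWithin {G : Type*} [NormedAddCommGroup G] [NormedSpace ℝ G]
    {F : E × H → G} (hF : ContDiffOn ℝ ((⊤ : ℕ∞) : WithTop ℕ∞) F (S ×ˢ K))
    (hu : UniqueDiffOn ℝ (S ×ˢ K)) :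
    ContDiffOn ℝ ((⊤ : ℕ∞) : WithTop ℕ∞) (fderivFstWithin F S K) (S ×ˢ K) := by
  have h := ((contDiffOn_infty_iff_fderivWithin hu).1 hF).2
  exact h.clm_comp contDiffOn_const

variable [MeasurableSpace H] [BorelSpace H]

lemma hasFDerivWithinAt_setIntegral {G : Type*} [NormedAddCommGroup G] [NormedSpace ℝ G]
    [CompleteSpace G]
    (hS : Convex ℝ S) (hK : IsCompact K) (hu : UniqueDiffOn ℝ (S ×ˢ K))
    (μ : Measure H) [IsFiniteMeasureOnCompacts μ] {F : E × H → G}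
    (hF : ContDiffOn ℝ ((⊤ : ℕ∞) : WithTop ℕ∞) F (S ×ˢ K)) {x : E} (hx : x ∈ S) :
    HasFDerivWithinAt (fun x => ∫ k in K, F (x, k) ∂μ)
      (∫ k in K, fderivFstWithin F S K (x, k) ∂μ) S x := by
  refine hasFDerivWithinAt_setIntegral_of_continuousOn hS hK μ (f := fun x k => F (x, k))
    (f' := fun x k => fderivFstWithin F S K (x, k)) ?_ ?_ ?_ hx
  · exact fun k hk x hx => hasFDerivWithinAt_fderivFstWithin (hF.differentiableOn (by simp)) hx hk
  · exact fun x hx => hF.continuousOn.comp (f := fun k => (x, k)) (by fun_prop)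
      fun k hk => ⟨hx, hk⟩
  · exact (contDiffOn_fderivFstWithin hF hu).continuousOn

/-- The integral of a smooth function over a compact set of parameters is smooth. -/
lemma contDiffOn_setIntegral {G : Type u} [NormedAddCommGroup G] [NormedSpace ℝ G]
    [CompleteSpace G]
    (hS : Convex ℝ S) (hSu : UniqueDiffOn ℝ S) (hK : IsCompact K) (hKu : UniqueDiffOn ℝ K)
    (μ : Measure H) [IsFiniteMeasureOnCompacts μ] {F : E × H → G}
    (hF : ContDiffOn ℝ ((⊤ : ℕ∞) : WithTop ℕ∞) F (S ×ˢ K)) :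
    ContDiffOn ℝ ((⊤ : ℕ∞) : WithTop ℕ∞) (fun x => ∫ k in K, F (x, k) ∂μ) S := by
  have hu := hSu.prod hKu
  rw [contDiffOn_infty]
  intro m
  -- The derivative is an integral with values in `E →L[ℝ] G`, so `G` has to vary; `E` and `G` share
  -- a universe so that this space stays in it.
  induction m generalizing G with
  | zero =>
    exact contDiffOn_zero.2 fun x hx =>
      (hasFDerivWithinAt_setIntegral hS hK hu μ hF hx).continuousWithinAt
  | succ m ih =>
    rw [Nat.cast_succ]
    refine contDiffOn_succ_of_fderivWithin (fun x hx =>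
      (hasFDerivWithinAt_setIntegral hS hK hu μ hF hx).differentiableWithinAt) (by simp) ?_
    refine (ih (contDiffOn_fderivFstWithin hF hu)).congr fun x hx => ?_
    exact (hasFDerivWithinAt_setIntegral hS hK hu μ hF hx).fderivWithin (hSu x hx)

end

end

/-! ### The homotopy operator and its inversion of `d` on closed forms. -/

section

/-- `ContinuousAlternatingMap.curryLeft` as a continuous linear map. -/
def curryLeftCLM (E : Type*) [NormedAddCommGroup E] [NormedSpace ℝ E] (r : ℕ) :
    (E [⋀^Fin (r + 1)]→L[ℝ] ℝ) →L[ℝ] (E →L[ℝ] E [⋀^Fin r]→L[ℝ] ℝ) :=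
  ContinuousAlternatingMap.curryLeftLI.toContinuousLinearMap

lemma curryLeftCLM_apply {E : Type*} [NormedAddCommGroup E] [NormedSpace ℝ E] {r : ℕ}
    (β : E [⋀^Fin (r + 1)]→L[ℝ] ℝ) : curryLeftCLM E r β = β.curryLeft := rfl

lemma contDiff_curryLeftCLM (E : Type*) [NormedAddCommGroup E] [NormedSpace ℝ E] (r : ℕ)
    {m : WithTop ℕ∞} : ContDiff ℝ m (curryLeftCLM E r) :=
  ContinuousLinearMap.contDiff (E := E [⋀^Fin (r + 1)]→L[ℝ] ℝ) (F := E →L[ℝ] E [⋀^Fin r]→L[ℝ] ℝ) _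

lemma HasFDerivWithinAt.curryLeft {E : Type*} [NormedAddCommGroup E] [NormedSpace ℝ E] {r : ℕ}
    {f : E → E [⋀^Fin (r + 1)]→L[ℝ] ℝ} {f' : E →L[ℝ] E [⋀^Fin (r + 1)]→L[ℝ] ℝ} {s : Set E} {x : E}
    (h : HasFDerivWithinAt f f' s x) :
    HasFDerivWithinAt (fun x => (f x).curryLeft) ((curryLeftCLM E r).comp f') s x := by
  have h0 : HasFDerivAt (curryLeftCLM E r) (curryLeftCLM E r) (f x) :=
    ContinuousLinearMap.hasFDerivAt (E := E [⋀^Fin (r + 1)]→L[ℝ] ℝ)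
      (F := E →L[ℝ] E [⋀^Fin r]→L[ℝ] ℝ) _
  exact HasFDerivAt.comp_hasFDerivWithinAt (E := E) (F := E [⋀^Fin (r + 1)]→L[ℝ] ℝ)
    (G := E →L[ℝ] E [⋀^Fin r]→L[ℝ] ℝ) x h0 h

/-- Cartan's formula `d ι_w α = ∂_w α - ι_w dα` for a constant vector `w`, where `f` is the
derivative of `α` at a point. In the alternating sum for `dα (w, v₀, …)` the term of index `0` is `f
w v`; the others have their signs shifted by one. -/
lemma ContinuousAlternatingMap.alternatizeUncurryFin_flip_curryLeft {E : Type*}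
    [NormedAddCommGroup E] [NormedSpace ℝ E] {r : ℕ} (f : E →L[ℝ] E [⋀^Fin (r + 1)]→L[ℝ] ℝ)
    (w : E) :
    alternatizeUncurryFin
        (((curryLeftCLM E r).comp f).flip w) =
      f w - (alternatizeUncurryFin f).curryLeft w := by
  ext v
  simp only [alternatizeUncurryFin_apply, sub_apply, curryLeft_apply_apply, Fin.sum_univ_succ,
    ContinuousLinearMap.flip_apply, ContinuousLinearMap.comp_apply,
    curryLeftCLM_apply]
  have hr : ∀ i : Fin (r + 1), Fin.removeNth i.succ (Matrix.vecCons w v) =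
      Matrix.vecCons w (Fin.removeNth i v) := fun i => by
    funext j
    refine Fin.cases ?_ (fun j => ?_) j <;> simp [Fin.removeNth]
  have h0 : Fin.removeNth 0 (Matrix.vecCons w v) = v := by
    funext j; simp [Fin.removeNth]
  have h1 : Fin.removeNth 1 (Matrix.vecCons w v) = Matrix.vecCons w (Fin.removeNth 0 v) := hr 0
  simp [pow_succ, hr, h0, h1]
  ring

variable {n r : ℕ}

/-- The integrand of the homotopy operator, `t ^ r • ι_{x - y} α (t x + (1 - t) y)`, as a function
of `(x, y, t)`. -/
def homotopyKernel (α : EuclideanSpace ℝ (Fin n) → EuclideanSpace ℝ (Fin n) [⋀^Fin (r + 1)]→L[ℝ] ℝ)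
    (z : EuclideanSpace ℝ (Fin n) × EuclideanSpace ℝ (Fin n) × ℝ) :
    EuclideanSpace ℝ (Fin n) [⋀^Fin r]→L[ℝ] ℝ :=
  z.2.2 ^ r • (α (z.2.2 • z.1 + (1 - z.2.2) • z.2.1)).curryLeft (z.1 - z.2.1)

/-- The derivative of `radialMap y` at `(x, t)` sends `(0, 1)` to `x - y` and `(v, 0)` to `t • v`;
the `r` vectors of the second kind produce `t ^ r`. -/
lemma homotopyOp_eq (y : EuclideanSpace ℝ (Fin n))
    (α : EuclideanSpace ℝ (Fin n) → EuclideanSpace ℝ (Fin n) [⋀^Fin (r + 1)]→L[ℝ] ℝ)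
    (x : EuclideanSpace ℝ (Fin n)) :
    homotopyOp y α x = ∫ t in (0 : ℝ)..1, homotopyKernel α (x, y, t) := by
  unfold homotopyOp
  congr 1
  funext t
  have hd : HasFDerivAt (radialMap y)
      (t • ContinuousLinearMap.fst ℝ (EuclideanSpace ℝ (Fin n)) ℝ +
        (ContinuousLinearMap.snd ℝ (EuclideanSpace ℝ (Fin n)) ℝ).smulRight (x - y)) (x, t) := by
    have h1 : HasFDerivAt (fun z : EuclideanSpace ℝ (Fin n) × ℝ => z.2 • z.1 + (1 - z.2) • y) _
        (x, t) := (hasFDerivAt_snd.fun_smul hasFDerivAt_fst).fun_add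
          (((hasFDerivAt_snd (𝕜 := ℝ)
            (p := ((x, t) : EuclideanSpace ℝ (Fin n) × ℝ))).const_sub (1 : ℝ)).smul_const y)
    refine h1.congr_fderiv ?_
    ext v <;> simp
    ring
  ext v
  simp only [formPullback, hd.fderiv, radialMap, homotopyKernel,
    ContinuousAlternatingMap.compContinuousLinearMap_apply,
    ContinuousAlternatingMap.curryLeft_apply_apply, ContinuousAlternatingMap.smul_apply]
  have hv : (⇑(t • ContinuousLinearMap.fst ℝ (EuclideanSpace ℝ (Fin n)) ℝ +
      (ContinuousLinearMap.snd ℝ (EuclideanSpace ℝ (Fin n)) ℝ).smulRight (x - y)) ∘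
        Matrix.vecCons ((0 : EuclideanSpace ℝ (Fin n)), (1 : ℝ))
          (⇑(ContinuousLinearMap.inl ℝ (EuclideanSpace ℝ (Fin n)) ℝ) ∘ v)) =
      Matrix.vecCons (x - y) (fun i => t • v i) := by
    funext i
    refine Fin.cases ?_ (fun i => ?_) i <;> simp
  rw [hv]
  have := ((α (t • x + (1 - t) • y)).curryLeft (x - y)).map_smul_univ (fun _ => t) v
  simpa using this

lemma segment_mem {D P : Set (EuclideanSpace ℝ (Fin n))} (hD : Convex ℝ D) (hP : P ⊆ D)
    {x y : EuclideanSpace ℝ (Fin n)} {t : ℝ} (hx : x ∈ D) (hy : y ∈ P) (ht : t ∈ Icc (0 : ℝ) 1) :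
    t • x + (1 - t) • y ∈ D :=
  hD hx (hP hy) ht.1 (sub_nonneg.2 ht.2) (by simp)

lemma contDiffOn_homotopyKernel {D P : Set (EuclideanSpace ℝ (Fin n))} (hD : Convex ℝ D)
    (hP : P ⊆ D) {m : WithTop ℕ∞}
    {α : EuclideanSpace ℝ (Fin n) → EuclideanSpace ℝ (Fin n) [⋀^Fin (r + 1)]→L[ℝ] ℝ}
    (hα : ContDiffOn ℝ m α D) :
    ContDiffOn ℝ m (homotopyKernel α) (D ×ˢ P ×ˢ Icc 0 1) := by
  unfold homotopyKernel
  have h1 : ContDiffOn ℝ m (fun z : EuclideanSpace ℝ (Fin n) × EuclideanSpace ℝ (Fin n) × ℝ =>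
      α (z.2.2 • z.1 + (1 - z.2.2) • z.2.1)) (D ×ˢ P ×ˢ Icc 0 1) :=
    hα.comp (f := fun z : EuclideanSpace ℝ (Fin n) × EuclideanSpace ℝ (Fin n) × ℝ =>
      z.2.2 • z.1 + (1 - z.2.2) • z.2.1) (by fun_prop)
      fun z hz => segment_mem hD hP hz.1 hz.2.1 hz.2.2
  have h2 := (contDiff_curryLeftCLM (EuclideanSpace ℝ (Fin n)) r).comp_contDiffOn h1
  have h3 : ContDiffOn ℝ m (fun z : EuclideanSpace ℝ (Fin n) × EuclideanSpace ℝ (Fin n) × ℝ =>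
      z.1 - z.2.1) (D ×ˢ P ×ˢ Icc 0 1) := by fun_prop
  have h4 : ContDiffOn ℝ m (fun z : EuclideanSpace ℝ (Fin n) × EuclideanSpace ℝ (Fin n) × ℝ =>
      z.2.2 ^ r) (D ×ˢ P ×ˢ Icc 0 1) := by fun_prop
  exact h4.smul (h2.clm_apply h3)

lemma continuousOn_homotopyKernel {D P : Set (EuclideanSpace ℝ (Fin n))} (hD : Convex ℝ D)
    (hP : P ⊆ D)
    {α : EuclideanSpace ℝ (Fin n) → EuclideanSpace ℝ (Fin n) [⋀^Fin (r + 1)]→L[ℝ] ℝ}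
    (hα : ContinuousOn α D) : ContinuousOn (homotopyKernel α) (D ×ˢ P ×ˢ Icc 0 1) :=
  (contDiffOn_homotopyKernel (m := 0) hD hP (contDiffOn_zero.2 hα)).continuousOn

lemma integrableOn_homotopyKernel {D P : Set (EuclideanSpace ℝ (Fin n))} (hD : Convex ℝ D)
    (hP : P ⊆ D) (hPc : IsCompact P)
    {α : EuclideanSpace ℝ (Fin n) → EuclideanSpace ℝ (Fin n) [⋀^Fin (r + 1)]→L[ℝ] ℝ}
    (hα : ContinuousOn α D) {x : EuclideanSpace ℝ (Fin n)} (hx : x ∈ D) :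
    IntegrableOn (fun k => homotopyKernel α (x, k)) (P ×ˢ Icc (0 : ℝ) 1) := by
  refine ContinuousOn.integrableOn_compact (hPc.prod isCompact_Icc) ?_
  exact (continuousOn_homotopyKernel hD hP hα).comp (f := fun k => (x, k)) (by fun_prop)
    fun k hk => ⟨hx, hk⟩

lemma homotopyOp_eq_setIntegral (y : EuclideanSpace ℝ (Fin n))
    (α : EuclideanSpace ℝ (Fin n) → EuclideanSpace ℝ (Fin n) [⋀^Fin (r + 1)]→L[ℝ] ℝ)
    (x : EuclideanSpace ℝ (Fin n)) :
    homotopyOp y α x = ∫ t in Icc (0 : ℝ) 1, homotopyKernel α (x, y, t) := by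
  rw [homotopyOp_eq, intervalIntegral.integral_of_le zero_le_one, integral_Icc_eq_integral_Ioc]

lemma integrableOn_homotopyOp {D P : Set (EuclideanSpace ℝ (Fin n))} (hD : Convex ℝ D)
    (hP : P ⊆ D) (hPc : IsCompact P)
    {α : EuclideanSpace ℝ (Fin n) → EuclideanSpace ℝ (Fin n) [⋀^Fin (r + 1)]→L[ℝ] ℝ}
    (hα : ContinuousOn α D) {x : EuclideanSpace ℝ (Fin n)} (hx : x ∈ D) :
    IntegrableOn (fun y => homotopyOp y α x) P := by
  have h := integrableOn_homotopyKernel hD hP hPc hα hx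
  rw [IntegrableOn, Measure.volume_eq_prod, ← Measure.prod_restrict] at h
  simp only [homotopyOp_eq_setIntegral]
  exact h.integral_prod_left

lemma avgHomotopyOp_eq {D P : Set (EuclideanSpace ℝ (Fin n))} (hD : Convex ℝ D)
    (hP : P ⊆ D) (hPc : IsCompact P)
    {α : EuclideanSpace ℝ (Fin n) → EuclideanSpace ℝ (Fin n) [⋀^Fin (r + 1)]→L[ℝ] ℝ}
    (hα : ContinuousOn α D) {x : EuclideanSpace ℝ (Fin n)} (hx : x ∈ D) :
    avgHomotopyOp P α x =
      (volume.real P)⁻¹ • ∫ k in P ×ˢ Icc (0 : ℝ) 1, homotopyKernel α (x, k) := by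
  rw [avgHomotopyOp, Measure.volume_eq_prod, setIntegral_prod]
  · simp only [homotopyOp_eq_setIntegral]
  · exact integrableOn_homotopyKernel hD hP hPc hα hx

/-- Averaging the homotopy operator over a compact convex set of base points preserves
smoothness. -/
lemma contDiffOn_avgHomotopyOp {D P : Set (EuclideanSpace ℝ (Fin n))} (hD : Convex ℝ D)
    (hDi : (interior D).Nonempty) (hP : P ⊆ D) (hPc : IsCompact P) (hPconv : Convex ℝ P)
    (hPi : (interior P).Nonempty)
    {α : EuclideanSpace ℝ (Fin n) → EuclideanSpace ℝ (Fin n) [⋀^Fin (r + 1)]→L[ℝ] ℝ}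
    (hα : ContDiffOn ℝ ((⊤ : ℕ∞) : WithTop ℕ∞) α D) :
    ContDiffOn ℝ ((⊤ : ℕ∞) : WithTop ℕ∞) (avgHomotopyOp P α) D := by
  refine ContDiffOn.congr (f := fun x => (volume.real P)⁻¹ •
    ∫ k in P ×ˢ Icc (0 : ℝ) 1, homotopyKernel α (x, k)) ?_
    fun x hx => avgHomotopyOp_eq hD hP hPc hα.continuousOn hx
  refine ContDiffOn.const_smul _ (contDiffOn_setIntegral hD (uniqueDiffOn_convex hD hDi)
    (hPc.prod isCompact_Icc) ((uniqueDiffOn_convex hPconv hPi).prod (uniqueDiffOn_Icc zero_lt_one))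
    volume (contDiffOn_homotopyKernel hD hP hα))

/-- Cartan's formula for the integrand of the homotopy operator applied to a closed form. -/
lemma alternatizeUncurryFin_fderivFstWithin_homotopyKernel
    {D P : Set (EuclideanSpace ℝ (Fin n))} (hD : Convex ℝ D)
    (hDi : (interior D).Nonempty) (hP : P ⊆ D)
    {α : EuclideanSpace ℝ (Fin n) → EuclideanSpace ℝ (Fin n) [⋀^Fin (r + 1)]→L[ℝ] ℝ}
    (hα : ContDiffOn ℝ ((⊤ : ℕ∞) : WithTop ℕ∞) α D)
    (hdα : ∀ x ∈ D, extDerivWithin α D x = 0) {x y : EuclideanSpace ℝ (Fin n)} {t : ℝ}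
    (hx : x ∈ D) (hy : y ∈ P) (ht : t ∈ Icc (0 : ℝ) 1) :
    ContinuousAlternatingMap.alternatizeUncurryFin
        (fderivFstWithin (homotopyKernel α) D (P ×ˢ Icc 0 1) (x, y, t)) =
      ((r + 1 : ℕ) * t ^ r) • α (t • x + (1 - t) • y) +
        t ^ (r + 1) • fderivWithin ℝ α D (t • x + (1 - t) • y) (x - y) := by
  have hu := uniqueDiffOn_convex hD hDi
  have hz : t • x + (1 - t) • y ∈ D :=
    segment_mem hD hP hx hy ht
  have h1 := hasFDerivWithinAt_fderivFstWithin (K := P ×ˢ Icc (0 : ℝ) 1) (k := (y, t))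
    ((contDiffOn_homotopyKernel hD hP hα).differentiableOn (by simp)) hx ⟨hy, ht⟩
  have hseg : HasFDerivWithinAt (fun x => t • x + (1 - t) • y)
      (t • ContinuousLinearMap.id ℝ (EuclideanSpace ℝ (Fin n))) D x :=
    ((hasFDerivWithinAt_id x D).const_smul t).add_const _
  have hαd : HasFDerivWithinAt α (fderivWithin ℝ α D (t • x + (1 - t) • y)) D
      (t • x + (1 - t) • y) := (hα.differentiableOn (by simp) _ hz).hasFDerivWithinAt
  have h2 := (hαd.comp x hseg fun w hw => segment_mem hD hP hw hy ht).curryLeft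
  -- Product rule. Differentiating the vector `x - y` and alternating gives `r + 1` copies of `α`;
  -- differentiating `α` gives a further factor `t` and, by Cartan's formula with `dα = 0`, the
  -- derivative of `α` along `x - y`.
  have h3 := (h2.clm_apply ((hasFDerivWithinAt_id x D).sub_const y)).const_smul (t ^ r)
  have h4 := (hu x hx).eq h1 h3
  rw [h4]
  have h5 : ContinuousAlternatingMap.alternatizeUncurryFin
      (fderivWithin ℝ α D (t • x + (1 - t) • y)) = 0 := hdα _ hz
  have h6 := ContinuousAlternatingMap.alternatizeUncurryFin_flip_curryLeft
    (fderivWithin ℝ α D (t • x + (1 - t) • y)) (x - y)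
  rw [h5, ContinuousAlternatingMap.curryLeft_zero] at h6
  simp only [ContinuousAlternatingMap.alternatizeUncurryFin_smul,
    ContinuousAlternatingMap.alternatizeUncurryFin_add]
  have h7 : ((curryLeftCLM (EuclideanSpace ℝ (Fin n)) r).comp
      ((fderivWithin ℝ α D (t • x + (1 - t) • y)).comp
        (t • ContinuousLinearMap.id ℝ (EuclideanSpace ℝ (Fin n))))).flip (id x - y) =
      t • ((curryLeftCLM (EuclideanSpace ℝ (Fin n)) r).comp
        (fderivWithin ℝ α D (t • x + (1 - t) • y))).flip (x - y) := by
    ext v m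
    simp
  rw [h7, ContinuousAlternatingMap.alternatizeUncurryFin_smul, h6, ContinuousLinearMap.comp_id,
    Function.comp_apply, ContinuousAlternatingMap.alternatizeUncurryFin_curryLeft,
    zero_apply, sub_zero, smul_add, smul_smul, ← pow_succ,
    ← Nat.cast_smul_eq_nsmul ℝ, smul_smul, mul_comm (t ^ r)]

/-- The integrand is the `t`-derivative of `t ^ (r + 1) • α (t x + (1 - t) y)`, which vanishes at `t
= 0` and equals `α x` at `t = 1`. -/
lemma integral_alternatizeUncurryFin_fderivFstWithin
    {D P : Set (EuclideanSpace ℝ (Fin n))} (hD : Convex ℝ D)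
    (hDi : (interior D).Nonempty) (hP : P ⊆ D)
    {α : EuclideanSpace ℝ (Fin n) → EuclideanSpace ℝ (Fin n) [⋀^Fin (r + 1)]→L[ℝ] ℝ}
    (hα : ContDiffOn ℝ ((⊤ : ℕ∞) : WithTop ℕ∞) α D)
    (hdα : ∀ x ∈ D, extDerivWithin α D x = 0) {x y : EuclideanSpace ℝ (Fin n)}
    (hx : x ∈ D) (hy : y ∈ P) :
    ∫ t in Icc (0 : ℝ) 1, ContinuousAlternatingMap.alternatizeUncurryFin
        (fderivFstWithin (homotopyKernel α) D (P ×ˢ Icc 0 1) (x, y, t)) = α x := by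
  have hseg : MapsTo (fun t : ℝ => t • x + (1 - t) • y) (Icc 0 1) D := fun t ht =>
    segment_mem hD hP hx hy ht
  have hcont : Continuous fun t : ℝ => t • x + (1 - t) • y := by fun_prop
  have hcp : ∀ m : ℕ, ContinuousOn (fun t : ℝ => t ^ m) (Icc 0 1) := fun m => by fun_prop
  have hcp' : ContinuousOn (fun t : ℝ => ((r + 1 : ℕ) : ℝ) * t ^ r) (Icc 0 1) := by fun_prop
  have hc1 : ContinuousOn (fun t : ℝ => α (t • x + (1 - t) • y)) (Icc 0 1) :=
    hα.continuousOn.comp hcont.continuousOn hseg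
  have hfc : ContinuousOn (fderivWithin ℝ α D) D :=
    (((contDiffOn_infty_iff_fderivWithin (uniqueDiffOn_convex hD hDi)).1 hα).2).continuousOn
  rw [setIntegral_congr_fun measurableSet_Icc fun t ht =>
    alternatizeUncurryFin_fderivFstWithin_homotopyKernel hD hDi hP hα hdα hx hy ht,
    integral_Icc_eq_integral_Ioc, ← intervalIntegral.integral_of_le zero_le_one]
  rw [intervalIntegral.integral_eq_sub_of_hasDerivAt_of_le (zero_le_one (α := ℝ))
    (f := fun t => t ^ (r + 1) • α (t • x + (1 - t) • y))]
  · simp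
  · exact (hcp (r + 1)).smul hc1
  · intro t ht
    have htI := Ioo_subset_Icc_self ht
    have h1 : HasDerivWithinAt (fun t : ℝ => t • x + (1 - t) • y) (x - y) (Icc 0 1) t := by
      have : HasDerivAt (fun t : ℝ => t • x + (1 - t) • y) ((1 : ℝ) • x + (-1 : ℝ) • y) t :=
        ((hasDerivAt_id t).smul_const x).add (((hasDerivAt_id t).const_sub 1).smul_const y)
      simpa [sub_eq_add_neg] using this.hasDerivWithinAt
    have h2 : HasFDerivWithinAt α (fderivWithin ℝ α D (t • x + (1 - t) • y)) D
      (t • x + (1 - t) • y) := (hα.differentiableOn (by simp) _ (hseg htI)).hasFDerivWithinAt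
    have h3 := (h2.comp_hasDerivWithinAt t h1 hseg).hasDerivAt (Icc_mem_nhds ht.1 ht.2)
    have h4 := (hasDerivAt_pow (r + 1) t).smul h3
    refine h4.congr_deriv ?_
    simp [add_comm]
  · refine ContinuousOn.intervalIntegrable ?_
    rw [uIcc_of_le zero_le_one]
    refine (hcp'.smul hc1).add ((hcp (r + 1)).smul ?_)
    exact (hfc.comp hcont.continuousOn hseg).clm_apply continuousOn_const

/-- The averaged homotopy operator inverts the exterior derivative on closed forms. -/
lemma extDerivWithin_avgHomotopyOp {D P : Set (EuclideanSpace ℝ (Fin n))} (hD : Convex ℝ D)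
    (hDi : (interior D).Nonempty) (hP : P ⊆ D) (hPc : IsCompact P) (hPconv : Convex ℝ P)
    (hPi : (interior P).Nonempty)
    {α : EuclideanSpace ℝ (Fin n) → EuclideanSpace ℝ (Fin n) [⋀^Fin (r + 1)]→L[ℝ] ℝ}
    (hα : ContDiffOn ℝ ((⊤ : ℕ∞) : WithTop ℕ∞) α D)
    (hdα : ∀ x ∈ D, extDerivWithin α D x = 0) {x : EuclideanSpace ℝ (Fin n)} (hx : x ∈ D) :
    extDerivWithin (avgHomotopyOp P α) D x = α x := by
  have hu := uniqueDiffOn_convex hD hDi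
  have hK : IsCompact (P ×ˢ Icc (0 : ℝ) 1) := hPc.prod isCompact_Icc
  have huK := hu.prod ((uniqueDiffOn_convex hPconv hPi).prod (uniqueDiffOn_Icc (zero_lt_one' ℝ)))
  have hker := contDiffOn_homotopyKernel hD hP hα
  rw [extDerivWithin_congr' (ω₂ := (volume.real P)⁻¹ • fun x =>
    ∫ k in P ×ˢ Icc (0 : ℝ) 1, homotopyKernel α (x, k))
    (fun x hx => avgHomotopyOp_eq hD hP hPc hα.continuousOn hx) hx,
    extDerivWithin_smul _ _ (hu x hx), extDerivWithin,
    (hasFDerivWithinAt_setIntegral hD hK huK volume hker hx).fderivWithin (hu x hx)]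
  have hint : IntegrableOn (fun k => fderivFstWithin (homotopyKernel α) D (P ×ˢ Icc 0 1) (x, k))
      (P ×ˢ Icc (0 : ℝ) 1) := by
    refine ContinuousOn.integrableOn_compact hK ?_
    exact (contDiffOn_fderivFstWithin hker huK).continuousOn.comp (f := fun k => (x, k))
      (by fun_prop) fun k hk => ⟨hx, hk⟩
  have hint2 := (ContinuousAlternatingMap.alternatizeUncurryFinCLM ℝ
    (EuclideanSpace ℝ (Fin n)) ℝ).integrable_comp hint
  rw [← ContinuousAlternatingMap.alternatizeUncurryFinCLM_apply,
    ← ContinuousLinearMap.integral_comp_comm _ hint, Measure.volume_eq_prod,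
    setIntegral_prod _ hint2]
  simp only [ContinuousAlternatingMap.alternatizeUncurryFinCLM_apply]
  -- Each base point already contributes `α x`, so the average does not depend on `P`.
  rw [setIntegral_congr_fun hPc.measurableSet fun y hy =>
    integral_alternatizeUncurryFin_fderivFstWithin hD hDi hP hα hdα hx hy, setIntegral_const,
    smul_smul, inv_mul_cancel₀, one_smul]
  have h1 : 0 < volume P := (isOpen_interior.measure_pos volume hPi).trans_le
    (measure_mono interior_subset)
  exact (ENNReal.toReal_pos h1.ne' hPc.measure_lt_top.ne).ne'

end

/-! ### `L^q → L^p` estimates for radial averages. -/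

section

/-- Hölder's inequality against the constant function `1`. -/
lemma lintegral_rpow_le_measure_univ_mul {X : Type*} [MeasurableSpace X] {μ : Measure X}
    {f : X → ENNReal} (hf : AEMeasurable f μ) {p : ℝ} (hp : 1 ≤ p) :
    (∫⁻ x, f x ∂μ) ^ p ≤ μ univ ^ (p - 1) * ∫⁻ x, f x ^ p ∂μ := by
  rcases hp.eq_or_lt with rfl | hp1
  · simp
  have hp0 : 0 < p := by linarith
  have hc := Real.HolderConjugate.conjExponent hp1
  have h := ENNReal.lintegral_mul_le_Lp_mul_Lq μ hc hf (g := fun _ => 1) aemeasurable_const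
  simp only [Pi.mul_apply, mul_one, ENNReal.one_rpow, lintegral_const, one_mul] at h
  calc (∫⁻ x, f x ∂μ) ^ p
      ≤ ((∫⁻ a, f a ^ p ∂μ) ^ (1 / p) * μ univ ^ (1 / p.conjExponent)) ^ p := by gcongr
    _ = _ := by
        rw [ENNReal.mul_rpow_of_nonneg _ _ hp0.le, ← ENNReal.rpow_mul, ← ENNReal.rpow_mul,
          one_div_mul_cancel hp0.ne', ENNReal.rpow_one, mul_comm]
        congr 2
        rw [Real.conjExponent]
        field_simp

/-- Minkowski's integral inequality, in the form needed for estimating an integral of a family of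
functions whose `L^p` norms are bounded by a multiple of a weight. -/
lemma lintegral_rpow_lintegral_le {X T : Type*} [MeasurableSpace X] [MeasurableSpace T]
    {μ : Measure X} {ν : Measure T} [SFinite μ] [SFinite ν] {F : X → T → ENNReal}
    (hF : Measurable (Function.uncurry F)) {w : T → ENNReal} (hw : Measurable w)
    (hw0 : ∀ᵐ t ∂ν, w t ≠ 0) (hwt : ∀ᵐ t ∂ν, w t ≠ ⊤) {p : ℝ} (hp : 1 ≤ p) (C : ENNReal)
    (h : ∀ᵐ t ∂ν, ∫⁻ x, F x t ^ p ∂μ ≤ (C * w t) ^ p) :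
    ∫⁻ x, (∫⁻ t, F x t ∂ν) ^ p ∂μ ≤ (C * ∫⁻ t, w t ∂ν) ^ p := by
  have hp0 : 0 ≤ p := by linarith
  set W := ∫⁻ t, w t ∂ν with hW
  have hFx : ∀ x, Measurable (F x) := fun x => hF.comp measurable_prodMk_left
  -- Hölder for `F x / w` and the measure `w dν` of mass `W`. The rest is Tonelli, and no duality is
  -- needed.
  have h1 : ∀ x, (∫⁻ t, F x t ∂ν) ^ p ≤ W ^ (p - 1) * ∫⁻ t, w t * (F x t / w t) ^ p ∂ν := by
    intro x
    have := lintegral_rpow_le_measure_univ_mul (μ := ν.withDensity w) (f := fun t => F x t / w t)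
      ((hFx x).div hw).aemeasurable hp
    have hm : Measurable fun t => F x t / w t := (hFx x).div hw
    rw [withDensity_apply _ MeasurableSet.univ, Measure.restrict_univ,
      lintegral_withDensity_eq_lintegral_mul _ hw hm,
      lintegral_withDensity_eq_lintegral_mul _ hw (hm.pow_const p)] at this
    refine le_trans (le_of_eq ?_) this
    congr 1
    refine lintegral_congr_ae ?_
    filter_upwards [hw0, hwt] with t h0 ht
    simp only [Pi.mul_apply]
    rw [ENNReal.mul_div_cancel h0 ht]
  calc ∫⁻ x, (∫⁻ t, F x t ∂ν) ^ p ∂μ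
      ≤ ∫⁻ x, W ^ (p - 1) * ∫⁻ t, w t * (F x t / w t) ^ p ∂ν ∂μ := lintegral_mono h1
    _ = W ^ (p - 1) * ∫⁻ t, ∫⁻ x, w t * (F x t / w t) ^ p ∂μ ∂ν := by
        have hm : Measurable (Function.uncurry fun x t => w t * (F x t / w t) ^ p) :=
          (hw.comp measurable_snd).mul ((hF.div (hw.comp measurable_snd)).pow_const p)
        rw [← lintegral_lintegral_swap hm.aemeasurable]
        exact lintegral_const_mul _ hm.lintegral_prod_right'
    _ ≤ W ^ (p - 1) * ∫⁻ t, w t * C ^ p ∂ν := by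
        gcongr 1
        refine lintegral_mono_ae ?_
        filter_upwards [hw0, hwt, h] with t h0 ht hle
        have hFt : Measurable fun x => F x t := hF.comp measurable_prodMk_right
        simp_rw [ENNReal.div_rpow_of_nonneg _ _ hp0, ENNReal.div_eq_inv_mul]
        rw [lintegral_const_mul _ ((hFt.pow_const p).const_mul _),
          lintegral_const_mul _ (hFt.pow_const p)]
        gcongr
        calc (w t ^ p)⁻¹ * ∫⁻ x, F x t ^ p ∂μ ≤ (w t ^ p)⁻¹ * (C * w t) ^ p := by gcongr
          _ = C ^ p := by
            rw [ENNReal.mul_rpow_of_nonneg _ _ hp0, mul_comm (C ^ p), ← mul_assoc,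
              ENNReal.inv_mul_cancel, one_mul]
            · exact (ENNReal.rpow_pos (pos_iff_ne_zero.2 h0) ht).ne'
            · exact ENNReal.rpow_ne_top_of_nonneg hp0 ht
    _ = (C * W) ^ p := by
        rw [lintegral_mul_const _ hw, ← hW, ENNReal.mul_rpow_of_nonneg _ _ hp0, ← mul_assoc,
          mul_comm (C ^ p)]
        congr 1
        nth_rw 2 [← ENNReal.rpow_one W]
        rw [← ENNReal.rpow_add_of_nonneg _ _ (by linarith) zero_le_one, sub_add_cancel]

variable {n : ℕ}

lemma lintegral_comp_add_smul {h : EuclideanSpace ℝ (Fin n) → ENNReal} (hh : Measurable h)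
    (a : EuclideanSpace ℝ (Fin n)) {s : ℝ} (hs : 0 < s) :
    ∫⁻ y, h (a + s • y) = ENNReal.ofReal (s ^ n)⁻¹ * ∫⁻ y, h y := by
  have h1 := Measure.map_addHaar_smul (volume : Measure (EuclideanSpace ℝ (Fin n))) hs.ne'
  have h2 : Measurable fun y => h (a + y) := hh.comp (measurable_const_add a)
  rw [← lintegral_map (f := fun y => h (a + y)) h2 (measurable_const_smul s), h1,
    lintegral_smul_measure, finrank_euclideanSpace_fin, abs_of_pos (by positivity),
    lintegral_add_left_eq_self h, smul_eq_mul]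

/-- The dependence of `t ↦ ‖g ↦ ∫_U g(t x + (1 - t) y) dy‖` on `t`. -/
def sliceWeight (n : ℕ) (p q t : ℝ) : ℝ :=
  min (t ^ ((n : ℝ) / p)) ((1 - t) ^ ((n : ℝ) / p)) * t ^ (-((n : ℝ) / p)) *
    (1 - t) ^ (-((n : ℝ) / q))

lemma sliceWeight_pos (n : ℕ) (p q : ℝ) {t : ℝ} (ht : t ∈ Ioo (0 : ℝ) 1) :
    0 < sliceWeight n p q t := by
  have h0 : 0 < t := ht.1
  have h1 : 0 < 1 - t := sub_pos.2 ht.2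
  have := lt_min (Real.rpow_pos_of_pos h0 ((n : ℝ) / p)) (Real.rpow_pos_of_pos h1 ((n : ℝ) / p))
  unfold sliceWeight
  positivity

/-- The form in which the weight arises: a power of a supremum bound times the better of two
Jacobians. -/
lemma sliceWeight_rpow {p q t : ℝ} (hp : 1 ≤ p) (hq : 1 ≤ q) (ht : t ∈ Ioo (0 : ℝ) 1) :
    sliceWeight n p q t ^ p =
      (((1 - t) ^ n)⁻¹) ^ (p / q - 1) * min ((1 - t) ^ n)⁻¹ (t ^ n)⁻¹ := by
  have h0 : 0 < t := ht.1
  have h1 : 0 < 1 - t := sub_pos.2 ht.2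
  have hp0 : 0 < p := by linarith
  have hq0 : 0 < q := by linarith
  have hmin : ∀ a b : ℝ, 0 ≤ a → 0 ≤ b → min a b ^ p = min (a ^ p) (b ^ p) := fun a b ha hb => by
    rcases le_total a b with h | h
    · rw [min_eq_left h, min_eq_left (Real.rpow_le_rpow ha h hp0.le)]
    · rw [min_eq_right h, min_eq_right (Real.rpow_le_rpow hb h hp0.le)]
  have e : ∀ a : ℝ, 0 < a → (a ^ ((n : ℝ) / p)) ^ p = a ^ n := fun a ha => by
    rw [← Real.rpow_mul ha.le, div_mul_cancel₀ _ hp0.ne', Real.rpow_natCast]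
  have hA : 0 < (1 - t) ^ n := by positivity
  have hB : 0 < t ^ n := by positivity
  unfold sliceWeight
  rw [Real.mul_rpow (by positivity) (by positivity), Real.mul_rpow (by positivity) (by positivity),
    hmin _ _ (by positivity) (by positivity), e t h0, e _ h1, Real.rpow_neg h0.le,
    Real.inv_rpow (by positivity), e t h0]
  have h2 : ((1 - t) ^ (-((n : ℝ) / q))) ^ p = (((1 - t) ^ n)⁻¹) ^ (p / q) := by
    rw [← Real.rpow_mul h1.le, ← Real.rpow_natCast, ← Real.rpow_neg h1.le, ← Real.rpow_mul h1.le]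
    congr 1
    field_simp
  have h3 : (((1 - t) ^ n)⁻¹) ^ (p / q) = (((1 - t) ^ n)⁻¹) ^ (p / q - 1) * ((1 - t) ^ n)⁻¹ := by
    rw [← Real.rpow_add_one (by positivity)]
    simp
  rw [h2, h3]
  have h4 : min (t ^ n) ((1 - t) ^ n) * (t ^ n)⁻¹ * ((1 - t) ^ n)⁻¹ =
      min ((1 - t) ^ n)⁻¹ (t ^ n)⁻¹ := by
    rcases le_total (t ^ n) ((1 - t) ^ n) with h | h
    · rw [min_eq_left h, min_eq_left ((inv_le_inv₀ hA hB).2 h), mul_inv_cancel₀ hB.ne', one_mul]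
    · rw [min_eq_right h, min_eq_right ((inv_le_inv₀ hB hA).2 h), mul_right_comm,
        mul_inv_cancel₀ hA.ne', one_mul]
  rw [← h4]
  ring

lemma measurable_comp_segment {g : EuclideanSpace ℝ (Fin n) → ENNReal} (hg : Measurable g) (t : ℝ) :
    Measurable fun z : EuclideanSpace ℝ (Fin n) × EuclideanSpace ℝ (Fin n) =>
      g (t • z.1 + (1 - t) • z.2) := by
  have : Measurable fun z : EuclideanSpace ℝ (Fin n) × EuclideanSpace ℝ (Fin n) =>
      t • z.1 + (1 - t) • z.2 := by fun_prop
  exact hg.comp this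

/-- Substituting in `y` costs `(1 - t) ^ (-n)`, substituting in `x` costs `t ^ (-n)`. This is the
source of the minimum in `poincareConst`. -/
lemma lintegral_lintegral_segment_le (U : Set (EuclideanSpace ℝ (Fin n)))
    {h : EuclideanSpace ℝ (Fin n) → ENNReal} (hh : Measurable h) {t : ℝ}
    (ht : t ∈ Ioo (0 : ℝ) 1) :
    ∫⁻ x in U, ∫⁻ y in U, h (t • x + (1 - t) • y) ≤
      volume U * ENNReal.ofReal (min ((1 - t) ^ n)⁻¹ (t ^ n)⁻¹) * ∫⁻ z, h z := by
  have h0 : 0 < t := ht.1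
  have h1 : 0 < 1 - t := sub_pos.2 ht.2
  rw [ENNReal.ofReal_mono.map_min, mul_min, min_mul]
  refine le_min ?_ ?_
  · calc ∫⁻ x in U, ∫⁻ y in U, h (t • x + (1 - t) • y)
        ≤ ∫⁻ x in U, ENNReal.ofReal ((1 - t) ^ n)⁻¹ * ∫⁻ z, h z := by
          refine lintegral_mono fun x => ?_
          rw [← lintegral_comp_add_smul hh (t • x) h1]
          exact setLIntegral_le_lintegral _ _
      _ = _ := by rw [setLIntegral_const]; ring
  · rw [lintegral_lintegral_swap (measurable_comp_segment hh t).aemeasurable]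
    calc ∫⁻ y in U, ∫⁻ x in U, h (t • x + (1 - t) • y)
        ≤ ∫⁻ y in U, ENNReal.ofReal (t ^ n)⁻¹ * ∫⁻ z, h z := by
          refine lintegral_mono fun y => ?_
          rw [← lintegral_comp_add_smul hh ((1 - t) • y) h0]
          simp_rw [add_comm ((1 - t) • y)]
          exact setLIntegral_le_lintegral _ _
      _ = _ := by rw [setLIntegral_const]; ring

/-- The `L^q → L^p` estimate for `g ↦ ∫_U g(t x + (1 - t) y) dy`. -/
lemma lintegral_rpow_segment_le {U : Set (EuclideanSpace ℝ (Fin n))} (hU0 : volume U ≠ 0)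
    (hU : volume U ≠ ⊤) {p q : ℝ} (hq : 1 ≤ q) (hqp : q ≤ p)
    {g : EuclideanSpace ℝ (Fin n) → ENNReal} (hg : Measurable g) {t : ℝ}
    (ht : t ∈ Ioo (0 : ℝ) 1) :
    ∫⁻ x in U, (∫⁻ y in U, g (t • x + (1 - t) • y)) ^ p ≤
      (volume U ^ (1 - 1 / q + 1 / p) * (∫⁻ z, g z ^ q) ^ (1 / q) *
        ENNReal.ofReal (sliceWeight n p q t)) ^ p := by
  have h0 : 0 < t := ht.1
  have h1 : 0 < 1 - t := sub_pos.2 ht.2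
  have hq0 : 0 < q := by linarith
  have hp0 : 0 < p := by linarith
  have hpq : 1 ≤ p / q := (one_le_div hq0).2 hqp
  set V := volume U
  set H := ∫⁻ z, g z ^ q
  set A := ENNReal.ofReal ((1 - t) ^ n)⁻¹
  have hgq : Measurable fun z => g z ^ q := hg.pow_const q
  set J : EuclideanSpace ℝ (Fin n) → ENNReal := fun x => ∫⁻ y in U, g (t • x + (1 - t) • y) ^ q
  have hJ : Measurable J := (measurable_comp_segment hgq t).lintegral_prod_right'
  have hJle : ∀ x, J x ≤ A * H := fun x => by
    rw [← lintegral_comp_add_smul hgq (t • x) h1]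
    exact setLIntegral_le_lintegral _ _
  -- After Hölder in `y`, split `J ^ (p / q) = J ^ (p / q - 1) * J`. The first factor is bounded by
  -- the supremum of `J`, its exponent being nonnegative as `q ≤ p`; the second is left for
  -- integration in `x`.
  have hpt : ∀ x, (∫⁻ y in U, g (t • x + (1 - t) • y)) ^ p ≤
      V ^ ((q - 1) * (p / q)) * (A * H) ^ (p / q - 1) * J x := fun x => by
    have hm : Measurable fun y => g (t • x + (1 - t) • y) :=
      (measurable_comp_segment hg t).comp measurable_prodMk_left
    have := lintegral_rpow_le_measure_univ_mul (μ := volume.restrict U) hm.aemeasurable hq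
    rw [Measure.restrict_apply_univ] at this
    calc _ = ((∫⁻ y in U, g (t • x + (1 - t) • y)) ^ q) ^ (p / q) := by
          rw [← ENNReal.rpow_mul, mul_div_cancel₀ _ hq0.ne']
      _ ≤ (V ^ (q - 1) * J x) ^ (p / q) := by gcongr
      _ = V ^ ((q - 1) * (p / q)) * (J x ^ (p / q - 1) * J x) := by
          rw [ENNReal.mul_rpow_of_nonneg _ _ (by positivity), ← ENNReal.rpow_mul]
          congr 1
          nth_rw 3 [← ENNReal.rpow_one (J x)]
          rw [← ENNReal.rpow_add_of_nonneg _ _ (by linarith) zero_le_one, sub_add_cancel]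
      _ ≤ V ^ ((q - 1) * (p / q)) * ((A * H) ^ (p / q - 1) * J x) := by
          gcongr
          exact hJle x
      _ = _ := by ring
  calc _ ≤ ∫⁻ x in U, V ^ ((q - 1) * (p / q)) * (A * H) ^ (p / q - 1) * J x := lintegral_mono hpt
    _ = V ^ ((q - 1) * (p / q)) * (A * H) ^ (p / q - 1) * ∫⁻ x in U, J x :=
        lintegral_const_mul _ hJ
    _ ≤ V ^ ((q - 1) * (p / q)) * (A * H) ^ (p / q - 1) *
        (V * ENNReal.ofReal (min ((1 - t) ^ n)⁻¹ (t ^ n)⁻¹) * H) := by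
        gcongr
        exact lintegral_lintegral_segment_le U hgq ht
    _ = (V ^ ((q - 1) * (p / q)) * V) * (H ^ (p / q - 1) * H) *
          (A ^ (p / q - 1) * ENNReal.ofReal (min ((1 - t) ^ n)⁻¹ (t ^ n)⁻¹)) := by
        rw [ENNReal.mul_rpow_of_nonneg _ _ (by linarith)]
        ring
    _ = _ := by
        have e1 : V ^ ((q - 1) * (p / q)) * V = (V ^ (1 - 1 / q + 1 / p)) ^ p := by
          nth_rw 2 [← ENNReal.rpow_one V]
          rw [← ENNReal.rpow_add _ _ hU0 hU, ← ENNReal.rpow_mul]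
          congr 1
          field_simp
        have e2 : H ^ (p / q - 1) * H = (H ^ (1 / q)) ^ p := by
          nth_rw 2 [← ENNReal.rpow_one H]
          rw [← ENNReal.rpow_add_of_nonneg _ _ (by linarith) zero_le_one, ← ENNReal.rpow_mul]
          congr 1
          field_simp
          ring
        have e3 : A ^ (p / q - 1) * ENNReal.ofReal (min ((1 - t) ^ n)⁻¹ (t ^ n)⁻¹) =
            ENNReal.ofReal (sliceWeight n p q t) ^ p := by
          rw [ENNReal.ofReal_rpow_of_nonneg (sliceWeight_pos n p q ht).le hp0.le,
            sliceWeight_rpow (by linarith) hq ht, ENNReal.ofReal_mul (by positivity),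
            ENNReal.ofReal_rpow_of_nonneg (by positivity) (by linarith)]
        rw [e1, e2, e3, ENNReal.mul_rpow_of_nonneg _ _ hp0.le, ENNReal.mul_rpow_of_nonneg _ _ hp0.le]

lemma poincareConst_eq_of_lt {p q : ℝ} (hpq : p < q) (r n : ℕ) :
    poincareConst p q r n = poincareConst q q r n := by
  rw [poincareConst, poincareConst, if_neg (not_le.2 hpq), if_pos le_rfl]

lemma poincareConst_integrand_eq (n r : ℕ) (p q : ℝ) {t : ℝ} (ht : t ∈ Ioo (0 : ℝ) 1) :
    min (t ^ ((n : ℝ) / p)) ((1 - t) ^ ((n : ℝ) / p)) * t ^ ((r : ℝ) - (n : ℝ) / p) *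
      (1 - t) ^ (-((n : ℝ) / q)) = t ^ r * sliceWeight n p q t := by
  rw [sliceWeight, sub_eq_add_neg (r : ℝ), Real.rpow_add ht.1, Real.rpow_natCast]
  ring

lemma measurable_sliceWeight (n : ℕ) (p q : ℝ) : Measurable (sliceWeight n p q) := by
  unfold sliceWeight
  fun_prop

/-- For `t ≤ 1 / 2` the minimum cancels the singularity at `0`; for `t ≥ 1 / 2` it softens the one
at `1` to the exponent `n / p - n / q`. -/
lemma sliceWeight_le (n : ℕ) {p q t : ℝ} (hp : 1 ≤ p) (hq : 1 ≤ q) (ht : t ∈ Ioo (0 : ℝ) 1) :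
    sliceWeight n p q t ≤
      2 ^ ((n : ℝ) / q) + 2 ^ ((n : ℝ) / p) * (1 - t) ^ ((n : ℝ) / p - (n : ℝ) / q) := by
  have h0 : 0 < t := ht.1
  have h1 : 0 < 1 - t := sub_pos.2 ht.2
  have key : ∀ s a : ℝ, 1 / 2 ≤ s → 0 ≤ a → s ^ (-a) ≤ 2 ^ a := fun s a hs ha => by
    rw [Real.rpow_neg (by linarith), ← Real.inv_rpow (by linarith)]
    refine Real.rpow_le_rpow (by positivity) ?_ ha
    rw [inv_le_comm₀ (by linarith) (by norm_num)]
    linarith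
  unfold sliceWeight
  rcases le_total t (1 / 2) with h | h
  · calc _ ≤ t ^ ((n : ℝ) / p) * t ^ (-((n : ℝ) / p)) * 2 ^ ((n : ℝ) / q) := by
          gcongr
          · exact min_le_left _ _
          · exact key _ _ (by linarith) (by positivity)
      _ = 2 ^ ((n : ℝ) / q) := by
          rw [← Real.rpow_add h0]; simp
      _ ≤ _ := le_add_of_nonneg_right (by positivity)
  · calc _ ≤ (1 - t) ^ ((n : ℝ) / p) * 2 ^ ((n : ℝ) / p) * (1 - t) ^ (-((n : ℝ) / q)) := by
          gcongr
          · exact min_le_right _ _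
          · exact key _ _ h (by positivity)
      _ = 2 ^ ((n : ℝ) / p) * (1 - t) ^ ((n : ℝ) / p - (n : ℝ) / q) := by
          rw [sub_eq_add_neg ((n : ℝ) / p), Real.rpow_add h1]; ring
      _ ≤ _ := le_add_of_nonneg_left (by positivity)

lemma integrableOn_pow_mul_sliceWeight {n : ℕ} (r : ℕ) {p q : ℝ} (hp : 1 ≤ p) (hq : 1 ≤ q)
    (h : -1 < (n : ℝ) / p - (n : ℝ) / q) :
    IntegrableOn (fun t => t ^ r * sliceWeight n p q t) (Ioo 0 1) := by
  have h1 : IntervalIntegrable (fun t : ℝ => (1 - t) ^ ((n : ℝ) / p - (n : ℝ) / q)) volume 0 1 := by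
    have := (intervalIntegral.intervalIntegrable_rpow' (a := 0) (b := 1) h).comp_sub_left 1
    simpa using this.symm
  have h2 : IntegrableOn (fun t : ℝ => (2 : ℝ) ^ ((n : ℝ) / q) +
      2 ^ ((n : ℝ) / p) * (1 - t) ^ ((n : ℝ) / p - (n : ℝ) / q)) (Ioo 0 1) := by
    have := (intervalIntegrable_const (c := (2 : ℝ) ^ ((n : ℝ) / q)) (μ := volume)).add
      (h1.const_mul (2 ^ ((n : ℝ) / p)))
    rw [intervalIntegrable_iff_integrableOn_Ioo_of_le zero_le_one] at this
    exact this
  refine h2.mono' ?_ ?_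
  · exact ((measurable_id.pow_const r).mul (measurable_sliceWeight n p q)).aestronglyMeasurable
  · filter_upwards [ae_restrict_mem measurableSet_Ioo] with t ht
    have hs := sliceWeight_pos n p q ht
    have h0 : 0 < t := ht.1
    rw [Real.norm_of_nonneg (by positivity)]
    calc _ ≤ 1 * sliceWeight n p q t := by
          gcongr
          exact pow_le_one₀ h0.le ht.2.le
      _ ≤ _ := by rw [one_mul]; exact sliceWeight_le n hp hq ht

lemma poincareConst_eq_setIntegral {p q : ℝ} (hqp : q ≤ p) (r n : ℕ) :
    poincareConst p q r n = ∫ t in Ioo (0 : ℝ) 1, t ^ r * sliceWeight n p q t := by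
  rw [poincareConst, if_pos hqp, intervalIntegral.integral_of_le zero_le_one,
    integral_Ioc_eq_integral_Ioo]
  exact setIntegral_congr_fun measurableSet_Ioo fun t ht => poincareConst_integrand_eq n r p q ht

/-- Integrability is essential: a divergent Bochner integral would be `0`. -/
lemma ofReal_poincareConst {n : ℕ} {p q : ℝ} (r : ℕ) (hq : 1 ≤ q) (hqp : q ≤ p)
    (h : -1 < (n : ℝ) / p - (n : ℝ) / q) :
    ENNReal.ofReal (poincareConst p q r n) =
      ∫⁻ t in Ioo (0 : ℝ) 1, ENNReal.ofReal (t ^ r * sliceWeight n p q t) := by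
  rw [poincareConst_eq_setIntegral hqp,
    ofReal_integral_eq_lintegral_ofReal
      (integrableOn_pow_mul_sliceWeight r (hq.trans hqp) hq h)]
  filter_upwards [ae_restrict_mem measurableSet_Ioo] with t ht
  exact mul_nonneg (pow_nonneg ht.1.le r) (sliceWeight_pos n p q ht).le

lemma poincareConst_pos_of_le {n : ℕ} {p q : ℝ} (r : ℕ) (hq : 1 ≤ q) (hqp : q ≤ p)
    (h : -1 < (n : ℝ) / p - (n : ℝ) / q) : 0 < poincareConst p q r n := by
  have hi := integrableOn_pow_mul_sliceWeight r (hq.trans hqp) hq h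
  rw [← intervalIntegrable_iff_integrableOn_Ioo_of_le zero_le_one] at hi
  rw [poincareConst_eq_setIntegral hqp, ← integral_Ioc_eq_integral_Ioo,
    ← intervalIntegral.integral_of_le zero_le_one]
  exact intervalIntegral.intervalIntegral_pos_of_pos_on hi
    (fun t ht => mul_pos (pow_pos ht.1 r) (sliceWeight_pos n p q ht)) zero_lt_one

/-- Case (i) says precisely that the power of `1 - t` is integrable at `t = 1`. -/
lemma neg_one_lt_div_sub_div {n : ℕ} (hn : 0 < n) {p q : ℝ} (h : 1 / q - 1 / p < 1 / (n : ℝ)) :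
    -1 < (n : ℝ) / p - (n : ℝ) / q := by
  have hn' : (0 : ℝ) < n := by exact_mod_cast hn
  rw [lt_div_iff₀ hn'] at h
  have : (n : ℝ) / p - (n : ℝ) / q = -((1 / q - 1 / p) * n) := by ring
  linarith

lemma poincareConst_pos {n : ℕ} (hn : 0 < n) {p q : ℝ} (r : ℕ) (hq : 1 ≤ q)
    (hpq : (q ≤ p ∧ 1 / q - 1 / p < 1 / (n : ℝ)) ∨ p < q) : 0 < poincareConst p q r n := by
  rcases hpq with ⟨h1, h2⟩ | h
  · exact poincareConst_pos_of_le r hq h1 (neg_one_lt_div_sub_div hn h2)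
  · rw [poincareConst_eq_of_lt h]
    exact poincareConst_pos_of_le r hq le_rfl (by simp)

lemma measurable_radial_inner (U : Set (EuclideanSpace ℝ (Fin n))) (r : ℕ)
    {g : EuclideanSpace ℝ (Fin n) → ENNReal} (hg : Measurable g) :
    Measurable fun z : EuclideanSpace ℝ (Fin n) × ℝ => ∫⁻ y in U,
      ENNReal.ofReal (z.2 ^ r) * g (z.2 • z.1 + (1 - z.2) • y) := by
  have h1 : Measurable fun z : (EuclideanSpace ℝ (Fin n) × ℝ) × EuclideanSpace ℝ (Fin n) =>
      ENNReal.ofReal (z.1.2 ^ r) * g (z.1.2 • z.1.1 + (1 - z.1.2) • z.2) := by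
    have h2 : Measurable fun z : (EuclideanSpace ℝ (Fin n) × ℝ) × EuclideanSpace ℝ (Fin n) =>
      z.1.2 • z.1.1 + (1 - z.1.2) • z.2 := by fun_prop
    have h3 : Measurable fun z : (EuclideanSpace ℝ (Fin n) × ℝ) × EuclideanSpace ℝ (Fin n) =>
      ENNReal.ofReal (z.1.2 ^ r) := by fun_prop
    exact h3.mul (hg.comp h2)
  exact h1.lintegral_prod_right'

lemma measurable_radial (U : Set (EuclideanSpace ℝ (Fin n))) (r : ℕ)
    {g : EuclideanSpace ℝ (Fin n) → ENNReal} (hg : Measurable g) :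
    Measurable fun x => ∫⁻ t in Ioo (0 : ℝ) 1, ∫⁻ y in U,
      ENNReal.ofReal (t ^ r) * g (t • x + (1 - t) • y) :=
  (measurable_radial_inner U r hg).lintegral_prod_right'

/-- The `L^q → L^p` estimate for the radial averages of `g`, in case `q ≤ p`. -/
lemma lintegral_rpow_radial_le {U : Set (EuclideanSpace ℝ (Fin n))} (hU0 : volume U ≠ 0)
    (hU : volume U ≠ ⊤) {p q : ℝ} (r : ℕ) (hq : 1 ≤ q) (hqp : q ≤ p)
    (h : -1 < (n : ℝ) / p - (n : ℝ) / q)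
    {g : EuclideanSpace ℝ (Fin n) → ENNReal} (hg : Measurable g) :
    ∫⁻ x in U, (∫⁻ t in Ioo (0 : ℝ) 1, ∫⁻ y in U,
        ENNReal.ofReal (t ^ r) * g (t • x + (1 - t) • y)) ^ p ≤
      (volume U ^ (1 - 1 / q + 1 / p) * (∫⁻ z, g z ^ q) ^ (1 / q) *
        ENNReal.ofReal (poincareConst p q r n)) ^ p := by
  have hp0 : 0 ≤ p := by linarith
  rw [ofReal_poincareConst r hq hqp h]
  refine lintegral_rpow_lintegral_le (μ := volume.restrict U) ?_ ?_ ?_ ?_ (hq.trans hqp) _ ?_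
  · exact measurable_radial_inner U r hg
  · exact ((measurable_id.pow_const r).mul (measurable_sliceWeight n p q)).ennreal_ofReal
  · filter_upwards [ae_restrict_mem measurableSet_Ioo] with t ht
    have := mul_pos (pow_pos ht.1 r) (sliceWeight_pos n p q ht)
    simpa using this
  · exact Filter.Eventually.of_forall fun t => ENNReal.ofReal_ne_top
  · filter_upwards [ae_restrict_mem measurableSet_Ioo] with t ht
    have hm : ∀ x, Measurable fun y => g (t • x + (1 - t) • y) := fun x =>
      (measurable_comp_segment hg t).comp measurable_prodMk_left
    simp_rw [lintegral_const_mul _ (hm _), ENNReal.mul_rpow_of_nonneg _ _ hp0]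
    rw [lintegral_const_mul _ ((measurable_comp_segment hg t).lintegral_prod_right'.pow_const p),
      ENNReal.ofReal_mul (pow_nonneg ht.1.le r), ENNReal.mul_rpow_of_nonneg _ _ hp0,
      mul_left_comm]
    gcongr
    refine (lintegral_rpow_segment_le hU0 hU hq hqp hg ht).trans_eq ?_
    rw [ENNReal.mul_rpow_of_nonneg _ _ hp0, ENNReal.mul_rpow_of_nonneg _ _ hp0]

/-- The `L^q → L^p` estimate for the radial averages of `g`. -/
lemma lintegral_rpow_radial_le' {U : Set (EuclideanSpace ℝ (Fin n))} (hU0 : volume U ≠ 0)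
    (hU : volume U ≠ ⊤) {p q : ℝ} (r : ℕ) (hn : 0 < n) (hp : 1 ≤ p) (hq : 1 ≤ q)
    (hpq : (q ≤ p ∧ 1 / q - 1 / p < 1 / (n : ℝ)) ∨ p < q)
    {g : EuclideanSpace ℝ (Fin n) → ENNReal} (hg : Measurable g) :
    ∫⁻ x in U, (∫⁻ t in Ioo (0 : ℝ) 1, ∫⁻ y in U,
        ENNReal.ofReal (t ^ r) * g (t • x + (1 - t) • y)) ^ p ≤
      (volume U ^ (1 - 1 / q + 1 / p) * (∫⁻ z, g z ^ q) ^ (1 / q) *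
        ENNReal.ofReal (poincareConst p q r n)) ^ p := by
  have hp0 : 0 < p := by linarith
  have hq0 : 0 < q := by linarith
  rcases hpq with ⟨h1, h2⟩ | hlt
  · exact lintegral_rpow_radial_le hU0 hU r hq h1 (neg_one_lt_div_sub_div hn h2) hg
  set M : EuclideanSpace ℝ (Fin n) → ENNReal := fun x => ∫⁻ t in Ioo (0 : ℝ) 1, ∫⁻ y in U,
    ENNReal.ofReal (t ^ r) * g (t • x + (1 - t) • y)
  have hM : Measurable M := measurable_radial U r hg
  -- For the pair `(q, q)` the exponent `n / q - n / q = 0` is always admissible; Hölder on `U` then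
  -- descends from `L^q` to `L^p`.
  have h1 := lintegral_rpow_radial_le hU0 hU r hq le_rfl (n := n) (by simp) hg
  have h2 := lintegral_rpow_le_measure_univ_mul (μ := volume.restrict U)
    (hM.pow_const p).aemeasurable ((one_le_div hp0).2 hlt.le)
  simp_rw [← ENNReal.rpow_mul, mul_div_cancel₀ q hp0.ne', Measure.restrict_apply_univ] at h2
  calc ∫⁻ x in U, M x ^ p = ((∫⁻ x in U, M x ^ p) ^ (q / p)) ^ (p / q) := by
        rw [← ENNReal.rpow_mul, div_mul_div_cancel₀ hp0.ne', div_self hq0.ne', ENNReal.rpow_one]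
    _ ≤ (volume U ^ (q / p - 1) * (volume U ^ (1 - 1 / q + 1 / q) * (∫⁻ z, g z ^ q) ^ (1 / q) *
          ENNReal.ofReal (poincareConst q q r n)) ^ q) ^ (p / q) := by
        gcongr
        exact h2.trans (by gcongr)
    _ = ((volume U ^ ((q / p - 1) / q) * volume U ^ (1 - 1 / q + 1 / q)) *
          (∫⁻ z, g z ^ q) ^ (1 / q) * ENNReal.ofReal (poincareConst q q r n)) ^ p := by
        rw [ENNReal.mul_rpow_of_nonneg _ _ (by positivity), ← ENNReal.rpow_mul,
          ← ENNReal.rpow_mul, mul_div_cancel₀ _ hq0.ne', mul_assoc (_ * _) _ (ENNReal.ofReal _),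
          mul_assoc (volume U ^ ((q / p - 1) / q)), ENNReal.mul_rpow_of_nonneg (volume U ^ _) _ hp0.le,
          ← ENNReal.rpow_mul]
        congr 2
        · ring
        · ring
    _ = _ := by
        rw [← ENNReal.rpow_add _ _ hU0 hU, poincareConst_eq_of_lt hlt]
        congr 4
        field_simp
        ring

end

/-! ### The pointwise majorant, its strict bound, and exhaustion by compact sets. -/

section

variable {n r : ℕ}

/-- The pointwise norm of a form, extended by zero outside `U`. -/
def formENorm (U : Set (EuclideanSpace ℝ (Fin n)))
    (α : EuclideanSpace ℝ (Fin n) → EuclideanSpace ℝ (Fin n) [⋀^Fin r]→L[ℝ] ℝ) :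
    EuclideanSpace ℝ (Fin n) → ENNReal :=
  U.indicator fun z => ‖formNorm (α z)‖ₑ

lemma measurable_formENorm {U : Set (EuclideanSpace ℝ (Fin n))} (hU : IsOpen U)
    {α : EuclideanSpace ℝ (Fin n) → EuclideanSpace ℝ (Fin n) [⋀^Fin r]→L[ℝ] ℝ}
    (hα : ContinuousOn α U) : Measurable (formENorm U α) := by
  classical
  have h : ContinuousOn (fun z => ‖formNorm (α z)‖ₑ) U :=
    continuous_enorm.comp_continuousOn (continuous_formNorm.comp_continuousOn hα)
  have := h.measurable_piecewise (g := fun _ => 0) continuousOn_const hU.measurableSet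
  rwa [formENorm, ← piecewise_eq_indicator]

lemma formLpNorm_eq {p : ℝ} (hp : 1 ≤ p) (D : Set (EuclideanSpace ℝ (Fin n)))
    (ξ : EuclideanSpace ℝ (Fin n) → EuclideanSpace ℝ (Fin n) [⋀^Fin r]→L[ℝ] ℝ) :
    formLpNorm p D ξ = (∫⁻ x in D, ‖formNorm (ξ x)‖ₑ ^ p) ^ (1 / p) := by
  have hp0 : 0 < p := by linarith
  rw [formLpNorm, eLpNorm_eq_eLpNorm' (by simpa using hp0) ENNReal.ofReal_ne_top,
    ENNReal.toReal_ofReal hp0.le, eLpNorm'_eq_lintegral_enorm]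

lemma lintegral_formENorm_rpow {U : Set (EuclideanSpace ℝ (Fin n))} (hU : MeasurableSet U)
    (α : EuclideanSpace ℝ (Fin n) → EuclideanSpace ℝ (Fin n) [⋀^Fin r]→L[ℝ] ℝ) {q : ℝ}
    (hq : 1 ≤ q) : (∫⁻ z, formENorm U α z ^ q) ^ (1 / q) = formLpNorm q U α := by
  rw [formLpNorm_eq hq, ← lintegral_indicator hU]
  congr 2
  funext z
  by_cases hz : z ∈ U
  · simp [formENorm, hz]
  · simp [formENorm, hz, show 0 < q by linarith]

/-- The measure space of base points and times. -/
abbrev baseMeasure (U : Set (EuclideanSpace ℝ (Fin n))) :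
    Measure (EuclideanSpace ℝ (Fin n) × ℝ) :=
  (volume.restrict U).prod (volume.restrict (Ioo (0 : ℝ) 1))

lemma baseMeasure_eq (U : Set (EuclideanSpace ℝ (Fin n))) :
    baseMeasure U = volume.restrict (U ×ˢ Ioo (0 : ℝ) 1) := by
  rw [baseMeasure, Measure.prod_restrict, Measure.volume_eq_prod]

/-- The integral that dominates the averaged homotopy operator pointwise. -/
def radialMajorant (U : Set (EuclideanSpace ℝ (Fin n))) (r : ℕ)
    (g : EuclideanSpace ℝ (Fin n) → ENNReal) (x : EuclideanSpace ℝ (Fin n)) : ENNReal :=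
  ∫⁻ k, ENNReal.ofReal (k.2 ^ r) * ENNReal.ofReal ‖x - k.1‖ * g (k.2 • x + (1 - k.2) • k.1)
    ∂baseMeasure U

lemma measurable_radial_joint {g : EuclideanSpace ℝ (Fin n) → ENNReal} (hg : Measurable g) :
    Measurable fun z : EuclideanSpace ℝ (Fin n) × EuclideanSpace ℝ (Fin n) × ℝ =>
      g (z.2.2 • z.1 + (1 - z.2.2) • z.2.1) := by
  have h2 : Measurable fun z : EuclideanSpace ℝ (Fin n) × EuclideanSpace ℝ (Fin n) × ℝ =>
    z.2.2 • z.1 + (1 - z.2.2) • z.2.1 := by fun_prop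
  exact hg.comp h2

lemma measurable_majorant_integrand (r : ℕ) {g : EuclideanSpace ℝ (Fin n) → ENNReal}
    (hg : Measurable g) :
    Measurable fun z : EuclideanSpace ℝ (Fin n) × EuclideanSpace ℝ (Fin n) × ℝ =>
      ENNReal.ofReal (z.2.2 ^ r) * ENNReal.ofReal ‖z.1 - z.2.1‖ *
        g (z.2.2 • z.1 + (1 - z.2.2) • z.2.1) := by
  have h3 : Measurable fun z : EuclideanSpace ℝ (Fin n) × EuclideanSpace ℝ (Fin n) × ℝ =>
      ENNReal.ofReal (z.2.2 ^ r) * ENNReal.ofReal ‖z.1 - z.2.1‖ := by fun_prop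
  exact h3.mul (measurable_radial_joint hg)

lemma measurable_radialMajorant (U : Set (EuclideanSpace ℝ (Fin n))) (r : ℕ)
    {g : EuclideanSpace ℝ (Fin n) → ENNReal} (hg : Measurable g) :
    Measurable (radialMajorant U r g) :=
  (measurable_majorant_integrand r hg).lintegral_prod_right'

/-- Puts the bound in the shape of `radialMajorant` with `R` in place of `‖x - y‖`, so that the two
can be compared under one integral. -/
lemma mul_radial_eq (U : Set (EuclideanSpace ℝ (Fin n))) (r : ℕ)
    {g : EuclideanSpace ℝ (Fin n) → ENNReal} (hg : Measurable g) (R : ℝ)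
    (x : EuclideanSpace ℝ (Fin n)) :
    ENNReal.ofReal R * ∫⁻ t in Ioo (0 : ℝ) 1, ∫⁻ y in U,
        ENNReal.ofReal (t ^ r) * g (t • x + (1 - t) • y) =
      ∫⁻ k, ENNReal.ofReal (k.2 ^ r) * ENNReal.ofReal R * g (k.2 • x + (1 - k.2) • k.1)
        ∂baseMeasure U := by
  have hm : Measurable fun k : EuclideanSpace ℝ (Fin n) × ℝ =>
      ENNReal.ofReal (k.2 ^ r) * g (k.2 • x + (1 - k.2) • k.1) := by
    have h3 : Measurable fun k : EuclideanSpace ℝ (Fin n) × ℝ => ENNReal.ofReal (k.2 ^ r) := by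
      fun_prop
    exact h3.mul ((measurable_radial_joint hg).comp measurable_prodMk_left)
  rw [← lintegral_prod_symm' (fun k : EuclideanSpace ℝ (Fin n) × ℝ =>
    ENNReal.ofReal (k.2 ^ r) * g (k.2 • x + (1 - k.2) • k.1)) hm, ← lintegral_const_mul _ hm]
  refine lintegral_congr fun k => ?_
  ring

lemma norm_sub_le_diam {U : Set (EuclideanSpace ℝ (Fin n))} (hb : Bornology.IsBounded U)
    {x y : EuclideanSpace ℝ (Fin n)} (hx : x ∈ U) (hy : y ∈ U) : ‖x - y‖ ≤ Metric.diam U := by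
  rw [← dist_eq_norm]
  exact Metric.dist_le_diam_of_mem hb hx hy

open Filter Topology in
/-- The diameter of a bounded open set is not attained. -/
lemma norm_sub_lt_diam {U : Set (EuclideanSpace ℝ (Fin n))} (hn : 0 < n) (hU : IsOpen U)
    (hb : Bornology.IsBounded U)
    {x y : EuclideanSpace ℝ (Fin n)} (hx : x ∈ U) (hy : y ∈ U) : ‖x - y‖ < Metric.diam U := by
  have : Nonempty (Fin n) := ⟨⟨0, hn⟩⟩
  rcases eq_or_ne x y with rfl | hxy
  · rw [sub_self, norm_zero]
    exact Metric.diam_pos (infinite_of_mem_nhds x (hU.mem_nhds hx)).nontrivial hb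
  -- Prolonging the segment beyond `x` stays in `U` for a while and multiplies its length by `1 +
  -- ε`.
  have hc : ContinuousAt (fun ε : ℝ => x + ε • (x - y)) 0 := by fun_prop
  have h1 : ∀ᶠ ε in 𝓝[>] (0 : ℝ), x + ε • (x - y) ∈ U :=
    (hc.eventually_mem (hU.mem_nhds (by simpa using hx))).filter_mono nhdsWithin_le_nhds
  obtain ⟨ε, hε, hε0⟩ := (h1.and self_mem_nhdsWithin).exists
  have hε0 : 0 < ε := hε0
  have h2 := norm_sub_le_diam hb hε hy
  have h3 : x + ε • (x - y) - y = (1 + ε) • (x - y) := by module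
  rw [h3, norm_smul, Real.norm_of_nonneg (by positivity)] at h2
  have h4 : 0 < ‖x - y‖ := norm_pos_iff.2 (sub_ne_zero.2 hxy)
  nlinarith

lemma ae_baseMeasure_mem {U : Set (EuclideanSpace ℝ (Fin n))} (hU : MeasurableSet U) :
    ∀ᵐ k ∂baseMeasure U, k ∈ U ×ˢ Ioo (0 : ℝ) 1 := by
  rw [baseMeasure_eq]
  exact ae_restrict_mem (hU.prod measurableSet_Ioo)

lemma radialMajorant_le {U : Set (EuclideanSpace ℝ (Fin n))} (hU : MeasurableSet U)
    (hb : Bornology.IsBounded U) (r : ℕ) {g : EuclideanSpace ℝ (Fin n) → ENNReal}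
    (hg : Measurable g) {x : EuclideanSpace ℝ (Fin n)} (hx : x ∈ U) :
    radialMajorant U r g x ≤ ENNReal.ofReal (Metric.diam U) * ∫⁻ t in Ioo (0 : ℝ) 1, ∫⁻ y in U,
        ENNReal.ofReal (t ^ r) * g (t • x + (1 - t) • y) := by
  rw [mul_radial_eq U r hg]
  refine lintegral_mono_ae ?_
  filter_upwards [ae_baseMeasure_mem hU] with k hk
  gcongr
  exact norm_sub_le_diam hb hx hk.1

-- Since `‖x - y‖` is less than the diameter, the integrands differ wherever `α (t x + (1 - t) y) ≠
-- 0`. This is an open set of `(y, t)`; once non-empty it has positive measure.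
open Filter Topology in
lemma radialMajorant_lt {U : Set (EuclideanSpace ℝ (Fin n))} (hn : 0 < n) (hU : IsOpen U)
    (hconv : Convex ℝ U) (hb : Bornology.IsBounded U)
    {α : EuclideanSpace ℝ (Fin n) → EuclideanSpace ℝ (Fin n) [⋀^Fin (r + 1)]→L[ℝ] ℝ}
    (hα : ContinuousOn α U) {z : EuclideanSpace ℝ (Fin n)} (hz : z ∈ U) (hαz : α z ≠ 0)
    {x : EuclideanSpace ℝ (Fin n)} (hx : x ∈ U)
    (hfin : radialMajorant U r (formENorm U α) x ≠ ⊤) :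
    radialMajorant U r (formENorm U α) x <
      ENNReal.ofReal (Metric.diam U) * ∫⁻ t in Ioo (0 : ℝ) 1, ∫⁻ y in U,
        ENNReal.ofReal (t ^ r) * formENorm U α (t • x + (1 - t) • y) := by
  have hg := measurable_formENorm hU hα
  rw [mul_radial_eq U r hg]
  have hopen : IsOpen (U ×ˢ Ioo (0 : ℝ) 1) := hU.prod isOpen_Ioo
  have hcont : Continuous fun k : EuclideanSpace ℝ (Fin n) × ℝ => k.2 • x + (1 - k.2) • k.1 := by
    fun_prop
  have hseg : ∀ k ∈ U ×ˢ Ioo (0 : ℝ) 1, k.2 • x + (1 - k.2) • k.1 ∈ U := fun k hk =>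
    segment_mem hconv subset_rfl hx hk.1 (Ioo_subset_Icc_self hk.2)
  set s := U ×ˢ Ioo (0 : ℝ) 1 ∩ (fun k => α (k.2 • x + (1 - k.2) • k.1)) ⁻¹' {0}ᶜ with hs
  have hsopen : IsOpen s :=
    (hα.comp hcont.continuousOn hseg).isOpen_inter_preimage hopen isOpen_compl_singleton
  have hsne : s.Nonempty := by
    -- This is the `y` with `t x + (1 - t) y = z`; it tends to `z` as `t → 0`, so it lies in `U` for
    -- small `t`.
    have hc : ContinuousAt (fun t : ℝ => (1 - t)⁻¹ • (z - t • x)) 0 := by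
      have h1 : ContinuousAt (fun t : ℝ => (1 - t)⁻¹) 0 :=
        ContinuousAt.inv₀ (f := fun t : ℝ => 1 - t) (by fun_prop) (by simp)
      exact h1.smul (f := fun t : ℝ => (1 - t)⁻¹) (g := fun t : ℝ => z - t • x) (by fun_prop)
    have h1 : ∀ᶠ t in 𝓝[>] (0 : ℝ), (1 - t)⁻¹ • (z - t • x) ∈ U :=
      (hc.eventually_mem (hU.mem_nhds (by simpa using hz))).filter_mono nhdsWithin_le_nhds
    obtain ⟨t, ht, ht1⟩ := (h1.and (Ioo_mem_nhdsGT (zero_lt_one' ℝ))).exists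
    refine ⟨((1 - t)⁻¹ • (z - t • x), t), ⟨ht, ht1⟩, ?_⟩
    have : t • x + (1 - t) • (1 - t)⁻¹ • (z - t • x) = z := by
      rw [smul_smul, mul_inv_cancel₀ (sub_pos.2 ht1.2).ne', one_smul]
      abel
    simpa [this] using hαz
  have hmx : Measurable fun k : EuclideanSpace ℝ (Fin n) × ℝ =>
      ENNReal.ofReal (k.2 ^ r) * ENNReal.ofReal (Metric.diam U) *
        formENorm U α (k.2 • x + (1 - k.2) • k.1) := by
    have h3 : Measurable fun k : EuclideanSpace ℝ (Fin n) × ℝ =>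
      ENNReal.ofReal (k.2 ^ r) * ENNReal.ofReal (Metric.diam U) := by fun_prop
    exact h3.mul ((measurable_radial_joint hg).comp measurable_prodMk_left)
  refine lintegral_strict_mono_of_ae_le_of_ae_lt_on hmx.aemeasurable hfin ?_ (s := s) ?_ ?_
  · filter_upwards [ae_baseMeasure_mem hU.measurableSet] with k hk
    gcongr
    exact norm_sub_le_diam hb hx hk.1
  · rw [baseMeasure_eq, Measure.restrict_apply hsopen.measurableSet,
      inter_eq_self_of_subset_left inter_subset_left]
    exact (hsopen.measure_pos volume hsne).ne'
  · refine Eventually.of_forall fun k hk => ?_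
    have hψ : formENorm U α (k.2 • x + (1 - k.2) • k.1) =
        ‖formNorm (α (k.2 • x + (1 - k.2) • k.1))‖ₑ := by
      rw [formENorm, indicator_of_mem (hseg k hk.1)]
    have hne : formNorm (α (k.2 • x + (1 - k.2) • k.1)) ≠ 0 := fun h =>
      hk.2 (formNorm_eq_zero.1 h)
    rw [hψ]
    refine ENNReal.mul_lt_mul_left (by simpa using hne) enorm_ne_top ?_
    refine ENNReal.mul_lt_mul_right ?_ ENNReal.ofReal_ne_top ?_
    · simpa using pow_pos hk.1.2.1 r
    · have h1 := norm_sub_lt_diam hn hU hb hx hk.1.1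
      exact (ENNReal.ofReal_lt_ofReal_iff ((norm_nonneg _).trans_lt h1)).2 h1

lemma enorm_formNorm_homotopyKernel_le {U : Set (EuclideanSpace ℝ (Fin n))}
    (hconv : Convex ℝ U)
    (α : EuclideanSpace ℝ (Fin n) → EuclideanSpace ℝ (Fin n) [⋀^Fin (r + 1)]→L[ℝ] ℝ)
    {x : EuclideanSpace ℝ (Fin n)} (hx : x ∈ U) {k : EuclideanSpace ℝ (Fin n) × ℝ}
    (hk : k ∈ U ×ˢ Ioo (0 : ℝ) 1) :
    ‖formNorm (homotopyKernel α (x, k))‖ₑ ≤ ENNReal.ofReal (k.2 ^ r) * ENNReal.ofReal ‖x - k.1‖ *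
      formENorm U α (k.2 • x + (1 - k.2) • k.1) := by
  have ht : 0 ≤ k.2 ^ r := pow_nonneg hk.2.1.le r
  rw [formENorm, indicator_of_mem (segment_mem hconv subset_rfl hx hk.1 (Ioo_subset_Icc_self hk.2)),
    Real.enorm_of_nonneg (formNorm_nonneg _), Real.enorm_of_nonneg (formNorm_nonneg _),
    ← ENNReal.ofReal_mul ht, ← ENNReal.ofReal_mul (by positivity), homotopyKernel, formNorm_smul,
    abs_of_nonneg ht, mul_assoc]
  gcongr
  exact formNorm_curryLeft_le _ _

lemma lintegral_enorm_formNorm_homotopyKernel_le {U : Set (EuclideanSpace ℝ (Fin n))}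
    (hU : MeasurableSet U) (hconv : Convex ℝ U)
    (α : EuclideanSpace ℝ (Fin n) → EuclideanSpace ℝ (Fin n) [⋀^Fin (r + 1)]→L[ℝ] ℝ)
    {x : EuclideanSpace ℝ (Fin n)} (hx : x ∈ U) :
    ∫⁻ k, ‖formNorm (homotopyKernel α (x, k))‖ₑ ∂baseMeasure U ≤
      radialMajorant U r (formENorm U α) x := by
  refine lintegral_mono_ae ?_
  filter_upwards [ae_baseMeasure_mem hU] with k hk
  exact enorm_formNorm_homotopyKernel_le hconv α hx hk

lemma aestronglyMeasurable_homotopyKernel {U : Set (EuclideanSpace ℝ (Fin n))}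
    (hU : IsOpen U) (hconv : Convex ℝ U)
    {α : EuclideanSpace ℝ (Fin n) → EuclideanSpace ℝ (Fin n) [⋀^Fin (r + 1)]→L[ℝ] ℝ}
    (hα : ContinuousOn α U) {x : EuclideanSpace ℝ (Fin n)} (hx : x ∈ U) :
    AEStronglyMeasurable (fun k => homotopyKernel α (x, k)) (baseMeasure U) := by
  rw [baseMeasure_eq]
  refine ContinuousOn.aestronglyMeasurable ?_ (hU.measurableSet.prod measurableSet_Ioo)
  exact (continuousOn_homotopyKernel hconv subset_rfl hα).comp (f := fun k => (x, k)) (by fun_prop)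
    fun k hk => ⟨hx, hk.1, Ioo_subset_Icc_self hk.2⟩

lemma homotopyOp_eq_integral_Ioo (y : EuclideanSpace ℝ (Fin n))
    (α : EuclideanSpace ℝ (Fin n) → EuclideanSpace ℝ (Fin n) [⋀^Fin (r + 1)]→L[ℝ] ℝ)
    (x : EuclideanSpace ℝ (Fin n)) :
    homotopyOp y α x = ∫ t in Ioo (0 : ℝ) 1, homotopyKernel α (x, y, t) := by
  rw [homotopyOp_eq_setIntegral, integral_Icc_eq_integral_Ioc, integral_Ioc_eq_integral_Ioo]

lemma integrableOn_homotopyOp_of_radialMajorant {U : Set (EuclideanSpace ℝ (Fin n))}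
    (hU : IsOpen U) (hconv : Convex ℝ U)
    {α : EuclideanSpace ℝ (Fin n) → EuclideanSpace ℝ (Fin n) [⋀^Fin (r + 1)]→L[ℝ] ℝ}
    (hα : ContinuousOn α U) {x : EuclideanSpace ℝ (Fin n)} (hx : x ∈ U)
    (hfin : radialMajorant U r (formENorm U α) x < ⊤) :
    IntegrableOn (fun y => homotopyOp y α x) U := by
  obtain ⟨C, hC, hle⟩ := exists_norm_le_formNorm n r
  have h1 : Integrable (fun k => formNorm (homotopyKernel α (x, k))) (baseMeasure U) := by
    refine ⟨continuous_formNorm.comp_aestronglyMeasurable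
      (aestronglyMeasurable_homotopyKernel hU hconv hα hx), ?_⟩
    exact (lintegral_enorm_formNorm_homotopyKernel_le hU.measurableSet hconv α hx).trans_lt hfin
  have h2 : Integrable (fun k => homotopyKernel α (x, k)) (baseMeasure U) :=
    (h1.const_mul C).mono' (aestronglyMeasurable_homotopyKernel hU hconv hα hx)
      (Filter.Eventually.of_forall fun k => hle _)
  simp only [homotopyOp_eq_integral_Ioo]
  exact h2.integral_prod_left

/-- The averages of the homotopy operator over subsets `P` of `U` are dominated pointwise. -/
lemma enorm_formNorm_avgHomotopyOp_le {U P : Set (EuclideanSpace ℝ (Fin n))}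
    (hU : IsOpen U) (hconv : Convex ℝ U) (hP : P ⊆ U) (hP0 : volume P ≠ 0) (hPt : volume P ≠ ⊤)
    {α : EuclideanSpace ℝ (Fin n) → EuclideanSpace ℝ (Fin n) [⋀^Fin (r + 1)]→L[ℝ] ℝ}
    (hα : ContinuousOn α U) {x : EuclideanSpace ℝ (Fin n)} (hx : x ∈ U) :
    ‖formNorm (avgHomotopyOp P α x)‖ₑ ≤
      (volume P)⁻¹ * radialMajorant U r (formENorm U α) x := by
  have hm : AEMeasurable (fun k => ‖formNorm (homotopyKernel α (x, k))‖ₑ) (baseMeasure U) :=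
    (continuous_formNorm.comp_aestronglyMeasurable
      (aestronglyMeasurable_homotopyKernel hU hconv hα hx)).enorm
  have hV : ENNReal.ofReal (volume.real P)⁻¹ = (volume P)⁻¹ := by
    rw [Measure.real, ENNReal.ofReal_inv_of_pos (ENNReal.toReal_pos hP0 hPt),
      ENNReal.ofReal_toReal hPt]
  rw [avgHomotopyOp, formNorm_smul, enorm_mul, abs_of_nonneg (by positivity),
    Real.enorm_of_nonneg (by positivity : 0 ≤ (volume.real P)⁻¹), hV]
  gcongr
  calc ‖formNorm (∫ y in P, homotopyOp y α x)‖ₑ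
      ≤ ∫⁻ y in P, ‖formNorm (homotopyOp y α x)‖ₑ := enorm_formNorm_integral_le _ _
    _ ≤ ∫⁻ y in U, ‖formNorm (homotopyOp y α x)‖ₑ := lintegral_mono_set hP
    _ ≤ ∫⁻ y in U, ∫⁻ t in Ioo (0 : ℝ) 1, ‖formNorm (homotopyKernel α (x, y, t))‖ₑ := by
        refine lintegral_mono fun y => ?_
        rw [homotopyOp_eq_integral_Ioo]
        exact enorm_formNorm_integral_le _ _
    _ = ∫⁻ k, ‖formNorm (homotopyKernel α (x, k))‖ₑ ∂baseMeasure U := (lintegral_prod _ hm).symm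
    _ ≤ _ := lintegral_enorm_formNorm_homotopyKernel_le hU.measurableSet hconv α hx

lemma formLpNorm_avgHomotopyOp_le {U P : Set (EuclideanSpace ℝ (Fin n))}
    (hU : IsOpen U) (hconv : Convex ℝ U) (hP : P ⊆ U) (hP0 : volume P ≠ 0) (hPt : volume P ≠ ⊤)
    {α : EuclideanSpace ℝ (Fin n) → EuclideanSpace ℝ (Fin n) [⋀^Fin (r + 1)]→L[ℝ] ℝ}
    (hα : ContinuousOn α U) {p : ℝ} (hp : 1 ≤ p) :
    formLpNorm p U (avgHomotopyOp P α) ≤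
      (volume P)⁻¹ * (∫⁻ x in U, radialMajorant U r (formENorm U α) x ^ p) ^ (1 / p) := by
  have hp0 : 0 < p := by linarith
  rw [formLpNorm_eq hp]
  calc _ ≤ (∫⁻ x in U, (volume P)⁻¹ ^ p * radialMajorant U r (formENorm U α) x ^ p) ^ (1 / p) := by
        refine ENNReal.rpow_le_rpow ?_ (by positivity)
        refine setLIntegral_mono' hU.measurableSet fun x hx => ?_
        rw [← ENNReal.mul_rpow_of_nonneg _ _ hp0.le]
        exact ENNReal.rpow_le_rpow
          (enorm_formNorm_avgHomotopyOp_le hU hconv hP hP0 hPt hα hx) hp0.le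
    _ = _ := by
        rw [lintegral_const_mul _
          ((measurable_radialMajorant U r (measurable_formENorm hU hα)).pow_const p),
          ENNReal.mul_rpow_of_nonneg _ _ (by positivity), ← ENNReal.rpow_mul,
          mul_one_div_cancel hp0.ne', ENNReal.rpow_one]

/-- The `L^p` bound for the majorant with the distances replaced by the diameter. -/
lemma lintegral_diam_mul_radial_rpow_le {U : Set (EuclideanSpace ℝ (Fin n))}
    (hU0 : volume U ≠ 0) (hU : volume U ≠ ⊤) (hn : 0 < n) {p q : ℝ} (r : ℕ) (hp : 1 ≤ p)
    (hq : 1 ≤ q) (hpq : (q ≤ p ∧ 1 / q - 1 / p < 1 / (n : ℝ)) ∨ p < q)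
    {g : EuclideanSpace ℝ (Fin n) → ENNReal} (hg : Measurable g) :
    (∫⁻ x in U, (ENNReal.ofReal (Metric.diam U) * ∫⁻ t in Ioo (0 : ℝ) 1, ∫⁻ y in U,
        ENNReal.ofReal (t ^ r) * g (t • x + (1 - t) • y)) ^ p) ^ (1 / p) ≤
      volume U * (ENNReal.ofReal (volume.real U ^ (1 / p - 1 / q) * poincareConst p q r n *
        Metric.diam U) * (∫⁻ z, g z ^ q) ^ (1 / q)) := by
  have hp0 : 0 < p := by linarith
  have hq0 : 0 < q := by linarith
  simp_rw [ENNReal.mul_rpow_of_nonneg _ _ hp0.le]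
  rw [lintegral_const_mul _ ((measurable_radial U r hg).pow_const p),
    ENNReal.mul_rpow_of_nonneg _ _ (by positivity), ← ENNReal.rpow_mul,
    mul_one_div_cancel hp0.ne', ENNReal.rpow_one]
  have h1 := ENNReal.rpow_le_rpow (lintegral_rpow_radial_le' hU0 hU r hn hp hq hpq hg)
    (by positivity : 0 ≤ 1 / p)
  rw [← ENNReal.rpow_mul, mul_one_div_cancel hp0.ne', ENNReal.rpow_one] at h1
  refine (mul_le_mul_right h1 _).trans_eq ?_
  have hV : 0 < volume.real U := ENNReal.toReal_pos hU0 hU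
  rw [ENNReal.ofReal_mul (mul_nonneg (by positivity) (poincareConst_pos hn r hq hpq).le),
    ENNReal.ofReal_mul (by positivity), ← ENNReal.ofReal_rpow_of_pos hV, Measure.real,
    -- One power of the volume is split off, to be compared with the normalisation of the average.
    ENNReal.ofReal_toReal hU, show 1 - 1 / q + 1 / p = 1 + (1 / p - 1 / q) by ring,
    ENNReal.rpow_add _ _ hU0 hU, ENNReal.rpow_one]
  ring

lemma formLpNorm_congr_set {D U : Set (EuclideanSpace ℝ (Fin n))} (h : D =ᵐ[volume] U) (p : ℝ)
    (ξ : EuclideanSpace ℝ (Fin n) → EuclideanSpace ℝ (Fin n) [⋀^Fin r]→L[ℝ] ℝ) :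
    formLpNorm p D ξ = formLpNorm p U ξ := by
  rw [formLpNorm, formLpNorm, Measure.restrict_congr_set h]

lemma avgHomotopyOp_congr_set {D U : Set (EuclideanSpace ℝ (Fin n))} (h : D =ᵐ[volume] U)
    (α : EuclideanSpace ℝ (Fin n) → EuclideanSpace ℝ (Fin n) [⋀^Fin (r + 1)]→L[ℝ] ℝ) :
    avgHomotopyOp D α = avgHomotopyOp U α := by
  funext x
  rw [avgHomotopyOp, avgHomotopyOp, Measure.restrict_congr_set h, measureReal_congr h]

open Filter Topology in
/-- A bounded open convex set is exhausted in measure by compact convex subsets. -/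
lemma exists_isCompact_convex_subset {U : Set (EuclideanSpace ℝ (Fin n))} (hU : IsOpen U)
    (hconv : Convex ℝ U) (hb : Bornology.IsBounded U) (hne : U.Nonempty) {S K : ENNReal}
    (hS : S < volume U * K) (hK : K ≠ ⊤) :
    ∃ P ⊆ U, IsCompact P ∧ Convex ℝ P ∧ (interior P).Nonempty ∧ S ≤ volume P * K := by
  obtain ⟨x0, hx0⟩ := hne
  -- The witness is the closure of `U` contracted towards `x0` by a ratio `c < 1`: it is compact,
  -- lies in `U`, and has volume at least `c ^ n` times that of `U`. A strict inequality survives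
  -- for `c` close to `1`.
  have h1 : Tendsto (fun c : ℝ => ENNReal.ofReal (c ^ n) * (volume U * K)) (𝓝[<] 1)
      (𝓝 (ENNReal.ofReal (1 ^ n) * (volume U * K))) := by
    refine ENNReal.Tendsto.mul_const ?_ (Or.inr (ENNReal.mul_ne_top hb.measure_lt_top.ne hK))
    have : Continuous fun c : ℝ => ENNReal.ofReal (c ^ n) :=
      ENNReal.continuous_ofReal.comp (continuous_pow n)
    exact (this.tendsto 1).mono_left nhdsWithin_le_nhds
  have h2 : S < ENNReal.ofReal (1 ^ n) * (volume U * K) := by simpa using hS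
  obtain ⟨c, hc, hc0, hc1⟩ :=
    ((h1.eventually_const_lt h2).and (Ioo_mem_nhdsLT (zero_lt_one' ℝ))).exists
  have himage : AffineMap.homothety x0 c '' U ⊆ AffineMap.homothety x0 c '' closure U :=
    image_mono subset_closure
  refine ⟨AffineMap.homothety x0 c '' closure U, ?_, ?_, ?_, ?_, ?_⟩
  · rintro _ ⟨y, hy, rfl⟩
    have := hconv.combo_interior_closure_mem_interior (hU.interior_eq.symm ▸ hx0) hy
      (sub_pos.2 hc1) hc0.le (sub_add_cancel 1 c)
    rw [hU.interior_eq] at this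
    convert this using 1
    rw [AffineMap.homothety_apply, vsub_eq_sub, vadd_eq_add]
    module
  · exact hb.isCompact_closure.image (AffineMap.homothety_continuous x0 c)
  · exact hconv.closure.affine_image _
  · refine Nonempty.mono (interior_maximal himage
      (AffineMap.homothety_isOpenMap x0 c hc0.ne' U hU)) (Nonempty.image _ ⟨x0, hx0⟩)
  · refine hc.le.trans ?_
    rw [← mul_assoc]
    gcongr
    refine le_trans (le_of_eq ?_) (measure_mono himage)
    rw [Measure.addHaar_image_homothety, finrank_euclideanSpace_fin, abs_of_nonneg (by positivity)]

end

/-! ### The exterior derivative within a convex set. -/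

section

variable {n r : ℕ}

lemma contDiffOn_extDerivWithin {D : Set (EuclideanSpace ℝ (Fin n))} (hD : UniqueDiffOn ℝ D)
    {ω : EuclideanSpace ℝ (Fin n) → EuclideanSpace ℝ (Fin n) [⋀^Fin r]→L[ℝ] ℝ}
    (hω : ContDiffOn ℝ ((⊤ : ℕ∞) : WithTop ℕ∞) ω D) :
    ContDiffOn ℝ ((⊤ : ℕ∞) : WithTop ℕ∞) (extDerivWithin ω D) D := by
  have h := ((contDiffOn_infty_iff_fderivWithin hD).1 hω).2
  have h2 : ContDiff ℝ ((⊤ : ℕ∞) : WithTop ℕ∞)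
      (ContinuousAlternatingMap.alternatizeUncurryFinCLM (n := r) ℝ (EuclideanSpace ℝ (Fin n)) ℝ) :=
    ContinuousLinearMap.contDiff
      (E := EuclideanSpace ℝ (Fin n) →L[ℝ] EuclideanSpace ℝ (Fin n) [⋀^Fin r]→L[ℝ] ℝ)
      (F := EuclideanSpace ℝ (Fin n) [⋀^Fin (r + 1)]→L[ℝ] ℝ) _
  exact h2.comp_contDiffOn h

lemma extDerivWithin_extDerivWithin_of_convex {D : Set (EuclideanSpace ℝ (Fin n))}
    (hD : Convex ℝ D) (hDi : (interior D).Nonempty)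
    {ω : EuclideanSpace ℝ (Fin n) → EuclideanSpace ℝ (Fin n) [⋀^Fin r]→L[ℝ] ℝ}
    (hω : ContDiffOn ℝ ((⊤ : ℕ∞) : WithTop ℕ∞) ω D) {x : EuclideanSpace ℝ (Fin n)} (hx : x ∈ D) :
    extDerivWithin (extDerivWithin ω D) D x = 0 := by
  refine extDerivWithin_extDerivWithin_apply (hω x hx) ?_ (uniqueDiffOn_convex hD hDi) ?_ hx
  · rw [minSmoothness_of_isRCLikeNormedField]
    exact WithTop.coe_le_coe.2 (le_top : (2 : ℕ∞) ≤ ⊤)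
  · rw [hD.closure_interior_eq_closure_of_nonempty_interior hDi]
    exact subset_closure hx

open Filter Topology in
/-- A continuous form on a convex set that vanishes in the interior vanishes. -/
lemma exists_mem_interior_ne_zero {D : Set (EuclideanSpace ℝ (Fin n))}
    (hD : Convex ℝ D) (hDi : (interior D).Nonempty)
    {α : EuclideanSpace ℝ (Fin n) → EuclideanSpace ℝ (Fin n) [⋀^Fin r]→L[ℝ] ℝ}
    (hα : ContinuousOn α D) {x : EuclideanSpace ℝ (Fin n)} (hx : x ∈ D) (hαx : α x ≠ 0) :
    ∃ z ∈ interior D, α z ≠ 0 := by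
  have hcl : x ∈ closure (interior D) := by
    rw [hD.closure_interior_eq_closure_of_nonempty_interior hDi]
    exact subset_closure hx
  have : (𝓝[interior D] x).NeBot := mem_closure_iff_nhdsWithin_neBot.1 hcl
  have h1 : ∀ᶠ z in 𝓝[interior D] x, α z ≠ 0 :=
    ((hα x hx).mono interior_subset).eventually_ne hαx
  obtain ⟨z, hz, hzi⟩ := (h1.and self_mem_nhdsWithin).exists
  exact ⟨z, hzi, hz⟩

lemma formLpNorm_lt_top_of_isCompact {D : Set (EuclideanSpace ℝ (Fin n))} (hD : IsCompact D)
    {α : EuclideanSpace ℝ (Fin n) → EuclideanSpace ℝ (Fin n) [⋀^Fin r]→L[ℝ] ℝ}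
    (hα : ContinuousOn α D) (q : ℝ) : formLpNorm q D α < ⊤ := by
  have hc : ContinuousOn (fun x => formNorm (α x)) D := continuous_formNorm.comp_continuousOn hα
  obtain ⟨C, hC⟩ := hD.exists_bound_of_continuousOn hc
  have : IsFiniteMeasure (volume.restrict D) :=
    ⟨by rw [Measure.restrict_apply_univ]; exact hD.measure_lt_top⟩
  refine (MemLp.of_bound (hc.aestronglyMeasurable hD.measurableSet) C ?_).2
  filter_upwards [ae_restrict_mem hD.measurableSet] with x hx using hC x hx

end

end

/-! ### The main theorem. -/

theorem theorem2p2 (n r : ℕ) (hn : 0 < n) (p q : ℝ) (hp : 1 ≤ p) (hq : 1 ≤ q)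
    (hpq : (q ≤ p ∧ 1 / q - 1 / p < 1 / (n : ℝ)) ∨ p < q)
    (D : Set (EuclideanSpace ℝ (Fin n))) (hconv : Convex ℝ D)
    (hbdd : Bornology.IsBounded D) (hint : (interior D).Nonempty)
    (ω : EuclideanSpace ℝ (Fin n) → EuclideanSpace ℝ (Fin n) [⋀^Fin r]→L[ℝ] ℝ)
    (hω : ContDiffOn ℝ ((⊤ : ℕ∞) : WithTop ℕ∞) ω D) :
    -- existence, for every bounded convex `D` with non-empty interior
    (∃ ξ : EuclideanSpace ℝ (Fin n) → EuclideanSpace ℝ (Fin n) [⋀^Fin r]→L[ℝ] ℝ,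
      ContDiffOn ℝ ((⊤ : ℕ∞) : WithTop ℕ∞) ξ D ∧
      (∀ x ∈ D, extDerivWithin ξ D x = extDerivWithin ω D x) ∧
      formLpNorm p D ξ ≤
        ENNReal.ofReal
            (volume.real D ^ (1 / p - 1 / q) * poincareConst p q r n * Metric.diam D) *
          formLpNorm q D (extDerivWithin ω D)) ∧
    -- the averaged homotopy operator: convergence of the integral, and the estimate
    (formLpNorm q D (extDerivWithin ω D) < ⊤ →
      (∀ᵐ x ∂(volume.restrict D),
        IntegrableOn (fun y => homotopyOp y (extDerivWithin ω D) x) D) ∧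
      formLpNorm p D (avgHomotopyOp D (extDerivWithin ω D)) ≤
        ENNReal.ofReal
            (volume.real D ^ (1 / p - 1 / q) * poincareConst p q r n * Metric.diam D) *
          formLpNorm q D (extDerivWithin ω D)) ∧
    -- on a compact `D` the right-hand side is finite and `ξ = A dω` itself is a solution
    (IsCompact D →
      formLpNorm q D (extDerivWithin ω D) < ⊤ ∧
      (∀ x ∈ D, IntegrableOn (fun y => homotopyOp y (extDerivWithin ω D) x) D) ∧
      ContDiffOn ℝ ((⊤ : ℕ∞) : WithTop ℕ∞) (avgHomotopyOp D (extDerivWithin ω D)) D ∧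
      ∀ x ∈ D, extDerivWithin (avgHomotopyOp D (extDerivWithin ω D)) D x =
        extDerivWithin ω D x) := by
  have hp0 : 0 < p := by linarith
  set α := extDerivWithin ω D with hαdef
  have hα : ContDiffOn ℝ ((⊤ : ℕ∞) : WithTop ℕ∞) α D :=
    contDiffOn_extDerivWithin (uniqueDiffOn_convex hconv hint) hω
  have hdα : ∀ x ∈ D, extDerivWithin α D x = 0 := fun x hx =>
    extDerivWithin_extDerivWithin_of_convex hconv hint hω hx
  set U := interior D with hUdef
  have hU : IsOpen U := isOpen_interior
  have hUD : U ⊆ D := interior_subset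
  have hUconv : Convex ℝ U := hconv.interior
  have hUb : Bornology.IsBounded U := hbdd.subset hUD
  have hαU : ContinuousOn α U := hα.continuousOn.mono hUD
  -- The frontier of a convex set is null, so norms and averages may be taken over the open set `U`.
  have hae : D =ᵐ[volume] U :=
    (interior_ae_eq_of_null_frontier (hconv.addHaar_frontier volume)).symm
  have hU0 : volume U ≠ 0 := (hU.measure_pos volume hint).ne'
  have hUt : volume U ≠ ⊤ := hUb.measure_lt_top.ne
  have hdiam : Metric.diam U = Metric.diam D := by
    rw [← Metric.diam_closure U, hconv.closure_interior_eq_closure_of_nonempty_interior hint,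
      Metric.diam_closure]
  have hreal : volume.real D = volume.real U := measureReal_congr hae
  rw [formLpNorm_congr_set hae q α, hreal, ← hdiam]
  simp only [formLpNorm_congr_set hae p]
  set c := volume.real U ^ (1 / p - 1 / q) * poincareConst p q r n * Metric.diam U with hc
  have hdiam0 : 0 < Metric.diam U := by
    obtain ⟨x, hx⟩ := hint
    simpa using norm_sub_lt_diam hn hU hUb hx hx
  have hc0 : 0 < c := mul_pos (mul_pos (Real.rpow_pos_of_pos (ENNReal.toReal_pos hU0 hUt) _)
    (poincareConst_pos hn r hq hpq)) hdiam0
  have hg := measurable_formENorm hU hαU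
  set N := radialMajorant U r (formENorm U α) with hN
  have hNm : Measurable N := measurable_radialMajorant U r hg
  set M := fun x => ENNReal.ofReal (Metric.diam U) * ∫⁻ t in Ioo (0 : ℝ) 1, ∫⁻ y in U,
    ENNReal.ofReal (t ^ r) * formENorm U α (t • x + (1 - t) • y) with hM
  have hNM : ∀ x ∈ U, N x ≤ M x := fun x hx => radialMajorant_le hU.measurableSet hUb r hg hx
  have hMle : (∫⁻ x in U, M x ^ p) ^ (1 / p) ≤
      volume U * (ENNReal.ofReal c * formLpNorm q U α) := by
    rw [← lintegral_formENorm_rpow hU.measurableSet α hq]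
    exact lintegral_diam_mul_radial_rpow_le hU0 hUt hn r hp hq hpq hg
  have hNle : (∫⁻ x in U, N x ^ p) ^ (1 / p) ≤
      volume U * (ENNReal.ofReal c * formLpNorm q U α) := by
    refine le_trans (ENNReal.rpow_le_rpow ?_ (by positivity)) hMle
    exact setLIntegral_mono' hU.measurableSet fun x hx => ENNReal.rpow_le_rpow (hNM x hx) hp0.le
  have hfin : formLpNorm q U α < ⊤ → ∫⁻ x in U, N x ^ p ≠ ⊤ := by
    intro hlt h
    rw [h, ENNReal.top_rpow_of_pos (by positivity)] at hNle
    exact (ENNReal.mul_lt_top hUt.lt_top (ENNReal.mul_lt_top ENNReal.ofReal_lt_top hlt)).not_ge hNle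
  have hNae : formLpNorm q U α < ⊤ → ∀ᵐ x ∂(volume.restrict U), N x < ⊤ := by
    intro hlt
    filter_upwards [ae_lt_top (hNm.pow_const p) (hfin hlt)] with x hx
    exact (ENNReal.rpow_lt_top_iff_of_pos hp0).1 hx
  refine ⟨?_, fun hlt => ⟨?_, ?_⟩, fun hcomp => ⟨?_, ?_, ?_, ?_⟩⟩
  · rcases eq_or_ne (formLpNorm q U α) ⊤ with htop | htop
    -- As `c > 0`, the right side is infinite and `ω` itself serves.
    · refine ⟨ω, hω, fun x _ => rfl, ?_⟩
      rw [htop, ENNReal.mul_top (by simpa using hc0)]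
      exact le_top
    -- For `α = 0` there is no slack, but `ξ = 0` works.
    by_cases hz : ∀ x ∈ D, α x = 0
    · refine ⟨fun _ => 0, contDiffOn_const, fun x hx => ?_, ?_⟩
      · rw [hz x hx]
        simp [extDerivWithin, ← ContinuousAlternatingMap.alternatizeUncurryFinCLM_apply]
      · simp [formLpNorm, formNorm_eq_zero.2]
    push Not at hz
    obtain ⟨x, hx, hαx⟩ := hz
    obtain ⟨z, hzU, hαz⟩ := exists_mem_interior_ne_zero hconv hint hα.continuousOn hx hαx
    have hlt : formLpNorm q U α < ⊤ := htop.lt_top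
    -- This slack pays for replacing `volume U` by the smaller `volume P`.
    have hstrict : (∫⁻ x in U, N x ^ p) ^ (1 / p) <
        volume U * (ENNReal.ofReal c * formLpNorm q U α) := by
      refine lt_of_lt_of_le (ENNReal.rpow_lt_rpow ?_ (by positivity)) hMle
      refine lintegral_strict_mono ?_ ?_ (hfin hlt) ?_
      · rwa [Ne, Measure.restrict_eq_zero]
      · exact (((measurable_radial U r hg).const_mul _).pow_const p).aemeasurable
      · filter_upwards [ae_restrict_mem hU.measurableSet, hNae hlt] with x hxU hNx
        exact ENNReal.rpow_lt_rpow
          (radialMajorant_lt hn hU hUconv hUb hαU hzU hαz hxU hNx.ne) hp0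
    obtain ⟨P, hPU, hPc, hPconv, hPi, hle⟩ := exists_isCompact_convex_subset hU hUconv hUb hint
      hstrict (ENNReal.mul_ne_top ENNReal.ofReal_ne_top htop)
    have hP0 : volume P ≠ 0 :=
      ((isOpen_interior.measure_pos volume hPi).trans_le (measure_mono interior_subset)).ne'
    have hPt : volume P ≠ ⊤ := hPc.measure_lt_top.ne
    refine ⟨avgHomotopyOp P α,
      contDiffOn_avgHomotopyOp hconv hint (hPU.trans hUD) hPc hPconv hPi hα,
      fun x hx => extDerivWithin_avgHomotopyOp hconv hint (hPU.trans hUD) hPc hPconv hPi hα hdα hx,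
      (formLpNorm_avgHomotopyOp_le hU hUconv hPU hP0 hPt hαU hp).trans ?_⟩
    calc _ ≤ (volume P)⁻¹ * (volume P * (ENNReal.ofReal c * formLpNorm q U α)) := by gcongr
      _ = _ := by rw [← mul_assoc, ENNReal.inv_mul_cancel hP0 hPt, one_mul]
  · rw [Measure.restrict_congr_set hae]
    filter_upwards [ae_restrict_mem hU.measurableSet, hNae hlt] with x hxU hNx
    rw [IntegrableOn, Measure.restrict_congr_set hae]
    exact integrableOn_homotopyOp_of_radialMajorant hU hUconv hαU hxU hNx
  · rw [avgHomotopyOp_congr_set hae]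
    refine (formLpNorm_avgHomotopyOp_le hU hUconv subset_rfl hU0 hUt hαU hp).trans ?_
    calc _ ≤ (volume U)⁻¹ * (volume U * (ENNReal.ofReal c * formLpNorm q U α)) := by gcongr
      _ = _ := by rw [← mul_assoc, ENNReal.inv_mul_cancel hU0 hUt, one_mul]
  · rw [← formLpNorm_congr_set hae]
    exact formLpNorm_lt_top_of_isCompact hcomp hα.continuousOn q
  -- A compact `D` can serve as its own set `P` of base points.
  · exact fun x hx => integrableOn_homotopyOp hconv subset_rfl hcomp hα.continuousOn hx
  · exact contDiffOn_avgHomotopyOp hconv hint subset_rfl hcomp hconv hint hα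
  · exact fun x hx => extDerivWithin_avgHomotopyOp hconv hint subset_rfl hcomp hconv hint hα hdα hx
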